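/- All manifolds are smooth, finite-dimensional (of fixed dimension), without boundary, Hausdorff and second countable. Let $\mathcal G$ be a Lie groupoid over a manifold $M$, with source and target submersions $s,t:\mathcal G\to M$, and let $x\in M$. The orbit of $x$ is $\mathcal O_x=\{t(g): g\in\mathcal G,\ s(g)=x\}$. Every orbit carries its canonical structure of an immersed submanifold of $M$, for which $t:s^{-1}(x)\to\mathcal O_x$ is a submersion; its tangent space at $t(g)$ is $T_{t(g)}\mathcal O_x=(dt)_g(\ker (ds)_g)$, for every arrow $g$ ending in $\mathcal O_x$. A slice at $x$ is an embedded submanifold $\Sigma\subset M$ with $x\in\Sigma$ such that (i) $\Sigma$ is transversal to every orbit it meets, i.e. $T_y\Sigma+T_y\mathcal O_y=T_yM$ for all $y\in\Sigma$; and (ii) $\dim\Sigma+\dim\mathcal O_x=\dim M$ and $\Sigma\cap\mathcal O_x=\{x\}$. Assume that $\mathcal G$ is proper at $x$, i.e. every sequence $(g_n)$ in $\mathcal G$ with $(s(g_n),t(g_n))\to(x,x)$ has a convergent subsequence. Then: 1. $\mathcal O_x$, with its canonical structure, is an embedded submanifold of $M$: the canonical topology of $\mathcal O_x$, i.e. the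 quotient topology from $t:s^{-1}(x)\to\mathcal O_x$, is the subspace topology, and with its canonical smooth structure the inclusion $\mathcal O_x\to M$ is a smooth embedding. 2. There exists a slice $\Sigma$ at $x$. -/

import Mathlib

open Set Filter Topology Manifold
open scoped ContDiff

/-- A Lie groupoid with manifold of arrows `G` (of dimension `n`) and manifold of objects `M`
(of dimension `m`).  An arrow `g` goes from `source g` to `target g`; the product `mul g h` is
the composition `g ∘ h`, defined when `source g = target h`.  The map `mul` is written as a total
function; its values on non-composable pairs carry no information, and all laws, as well as
smoothness, are required on the set of composable pairs only.  (This set is an embedded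
submanifold of `G × G`; `ContMDiffOn` on it is smoothness on that submanifold.) -/
structure LieGroupoid (n m : ℕ) (G M : Type*)
    [TopologicalSpace G] [ChartedSpace (EuclideanSpace ℝ (Fin n)) G]
    [TopologicalSpace M] [ChartedSpace (EuclideanSpace ℝ (Fin m)) M] where
  source : G → M
  target : G → M
  unit : M → G
  inv : G → G
  mul : G → G → G
  source_unit : ∀ y, source (unit y) = y
  target_unit : ∀ y, target (unit y) = y
  source_mul : ∀ g h, source g = target h → source (mul g h) = source h
  target_mul : ∀ g h, source g = target h → target (mul g h) = target g
  mul_assoc : ∀ g h k, source g = target h → source h = target k →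
    mul (mul g h) k = mul g (mul h k)
  unit_mul : ∀ g, mul (unit (target g)) g = g
  mul_unit : ∀ g, mul g (unit (source g)) = g
  source_inv : ∀ g, source (inv g) = target g
  target_inv : ∀ g, target (inv g) = source g
  inv_mul : ∀ g, mul (inv g) g = unit (source g)
  mul_inv : ∀ g, mul g (inv g) = unit (target g)
  isSubmersion_source : IsSubmersion (𝓡 n) (𝓡 m) ∞ source
  isSubmersion_target : IsSubmersion (𝓡 n) (𝓡 m) ∞ target
  contMDiff_unit : ContMDiff (𝓡 m) (𝓡 n) ∞ unit
  contMDiff_inv : ContMDiff (𝓡 n) (𝓡 n) ∞ inv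
  contMDiffOn_mul : ContMDiffOn ((𝓡 n).prod (𝓡 n)) (𝓡 n) ∞ (fun p : G × G => mul p.1 p.2)
    {p : G × G | source p.1 = target p.2}

/-- The structure of an embedded submanifold on a subset `S` of the `m`-dimensional manifold `M`:
a smooth structure on `S`, with the subspace topology, of some dimension `dim`, for which the
inclusion `S → M` is a smooth embedding. -/
structure EmbeddedSubmanifold (m : ℕ) {M : Type*}
    [TopologicalSpace M] [ChartedSpace (EuclideanSpace ℝ (Fin m)) M] (S : Set M) where
  dim : ℕ
  chartedSpace : ChartedSpace (EuclideanSpace ℝ (Fin dim)) S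
  isManifold : IsManifold (𝓡 dim) ∞ S
  isSmoothEmbedding : IsSmoothEmbedding (𝓡 dim) (𝓡 m) ∞ (Subtype.val : S → M)

/-- The tangent space of an embedded submanifold of `M` at `y`, as a subspace of the tangent space
of `M`. -/
noncomputable def EmbeddedSubmanifold.tangentSpace {m : ℕ} {M : Type*}
    [TopologicalSpace M] [ChartedSpace (EuclideanSpace ℝ (Fin m)) M] {S : Set M}
    (N : EmbeddedSubmanifold m S) (y : S) : Submodule ℝ (TangentSpace (𝓡 m) (y : M)) :=
  letI := N.chartedSpace
  LinearMap.range (mfderiv (𝓡 N.dim) (𝓡 m) (Subtype.val : S → M) y).toLinearMap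

namespace LieGroupoid

variable {n m : ℕ} {G M : Type*}
  [TopologicalSpace G] [ChartedSpace (EuclideanSpace ℝ (Fin n)) G]
  [TopologicalSpace M] [ChartedSpace (EuclideanSpace ℝ (Fin m)) M]

/-- The groupoid is proper at `x`: every sequence of arrows whose sources and targets both converge
to `x` has a convergent subsequence. -/
def IsProperAt (Γ : LieGroupoid n m G M) (x : M) : Prop :=
  ∀ g : ℕ → G, Tendsto (fun i => (Γ.source (g i), Γ.target (g i))) atTop (𝓝 (x, x)) →
    ∃ (a : G) (φ : ℕ → ℕ), StrictMono φ ∧ Tendsto (g ∘ φ) atTop (𝓝 a)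

/-- The orbit of `x`: all points that are the target of an arrow starting at `x`. -/
def orbit (Γ : LieGroupoid n m G M) (x : M) : Set M :=
  {y | ∃ g : G, Γ.source g = x ∧ Γ.target g = y}

/-- The target map, as a map from the source fibre at `x` onto the orbit of `x`. -/
def orbitMap (Γ : LieGroupoid n m G M) (x : M) (g : {g : G // Γ.source g = x}) : Γ.orbit x :=
  ⟨Γ.target g, g, g.2, rfl⟩

/-- The tangent space at `target g` of the orbit through `target g`.  An orbit carries the smooth
structure of an immersed submanifold for which the target map from the source fibre of `source g`
onto the orbit is a submersion; its tangent space at `target g` is therefore the image under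
`d target` of the tangent space `ker (d source)` at `g` of that source fibre.  It depends on
`target g` only. -/
noncomputable def orbitTangentSpace (Γ : LieGroupoid n m G M) (g : G) :
    Submodule ℝ (TangentSpace (𝓡 m) (Γ.target g)) :=
  (LinearMap.ker (mfderiv (𝓡 n) (𝓡 m) Γ.source g).toLinearMap).map
    (mfderiv (𝓡 n) (𝓡 m) Γ.target g).toLinearMap

/-- The embedded submanifold structure `O` on the orbit of `x` is the canonical (immersed) structure
of the orbit, the one for which the target map from the source fibre at `x` onto the orbit is a
submersion: the topologies agree (the subspace topology of the orbit is the quotient topology from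
the source fibre), and the tangent spaces agree. -/
structure IsOrbitStructure (Γ : LieGroupoid n m G M) {x : M}
    (O : EmbeddedSubmanifold m (Γ.orbit x)) : Prop where
  isQuotientMap : IsQuotientMap (Γ.orbitMap x)
  tangentSpace_eq : ∀ g : {g : G // Γ.source g = x},
    O.tangentSpace (Γ.orbitMap x g) = Γ.orbitTangentSpace (g : G)

/-- The embedded submanifold `S` of `M` is a slice at `x`. The dimension of the orbit of `x` is read
off from its tangent space at `x`, and transversality to the orbits at the points of `S` is tested
at all arrows ending in `S` (every point of `S` is the target of its unit). -/
structure IsSlice (Γ : LieGroupoid n m G M) (x : M) {S : Set M}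
    (N : EmbeddedSubmanifold m S) : Prop where
  mem : x ∈ S
  transversal : ∀ (g : G) (hg : Γ.target g ∈ S),
    N.tangentSpace ⟨Γ.target g, hg⟩ ⊔ Γ.orbitTangentSpace g = ⊤
  dim_add_finrank : N.dim + Module.finrank ℝ (Γ.orbitTangentSpace (Γ.unit x)) = m
  inter_orbit : S ∩ Γ.orbit x = {x}

end LieGroupoid

/-! Write s, t for source and target. The orbit directions dt(ker ds) at an arrow depend only on its
target, because right translation preserves targets. Their dimension k is the same along a whole
orbit, because inversion exchanges s and t (`finrank_orbitDirection_eq`).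

Through an arrow g there is a family of arrows on which t is a local diffeomorphism and whose first
k directions lie in ker ds. Inverting t on it gives a chart of M around t(g) whose plaques each lie
in a single orbit (`nonempty_orbitBox`). Neighbouring orbits may be larger than their plaques, but
the orbit of x has dimension k everywhere, so it is tangent to the plaques, and the transverse
coordinate of t is locally constant on the source fibre of x (`eventually_snd_chart_target_eq`).

Properness prevents plaques of the orbit from accumulating. If arrows hᵢ from x have targets tending
to t(g), with s(g) = x, choose kᵢ → g with t(kᵢ) = t(hᵢ). Then kᵢ⁻¹hᵢ starts at x and its target
tends to x, so a subsequence of it converges, and with it one of hᵢ (`exists_subseq_tendsto`). Local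
constancy near the limit arrow puts some hᵢ on the central plaque. Hence a small box meets the orbit
in exactly that plaque (`exists_orbitBox`), which makes the orbit embedded; the same compactness
makes t closed from the source fibre onto the orbit, hence a quotient map. The slice is the
transversal on which the plaque coordinate vanishes: at each of its points the missing directions
are tangent to a plaque, hence to an orbit. -/

/-! ### Derivatives and velocities in the model vector spaces -/

section Derivative

variable {E E' E'' H H' H'' : Type*} [NormedAddCommGroup E] [NormedSpace ℝ E]
  [NormedAddCommGroup E'] [NormedSpace ℝ E'] [NormedAddCommGroup E''] [NormedSpace ℝ E'']
  [TopologicalSpace H] [TopologicalSpace H'] [TopologicalSpace H'']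
  (I : ModelWithCorners ℝ E H) (I' : ModelWithCorners ℝ E' H') (I'' : ModelWithCorners ℝ E'' H'')
  {P Q R : Type*} [TopologicalSpace P] [ChartedSpace H P] [TopologicalSpace Q] [ChartedSpace H' Q]
  [TopologicalSpace R] [ChartedSpace H'' R]

/-- The manifold derivative, as a linear map between the model vector spaces. -/
noncomputable def modelDeriv (f : P → Q) (p : P) : E →L[ℝ] E' := mfderiv I I' f p

/-- The velocity of a curve, as an element of the model vector space. -/
noncomputable def velocity (c : ℝ → P) (τ : ℝ) : E := modelDeriv 𝓘(ℝ, ℝ) I c τ 1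

variable {I I' I''}

/-- The base point `q` is separate from `f p`, so that it can be replaced by an equal point without
transport between tangent spaces. -/
theorem modelDeriv_comp_apply {g : Q → R} {f : P → Q} {p : P} {q : Q}
    (hg : MDifferentiableAt I' I'' g q) (hf : MDifferentiableAt I I' f p) (h : f p = q) (v : E) :
    modelDeriv I I'' (g ∘ f) p v = modelDeriv I' I'' g q (modelDeriv I I' f p v) :=
  mfderiv_comp_apply_of_eq p hg hf h v

theorem velocity_comp {f : P → Q} {c : ℝ → P} {τ : ℝ} {p : P}
    (hf : MDifferentiableAt I I' f p) (hc : MDifferentiableAt 𝓘(ℝ, ℝ) I c τ) (h : c τ = p) :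
    velocity I' (f ∘ c) τ = modelDeriv I I' f p (velocity I c τ) :=
  modelDeriv_comp_apply hf hc h 1

theorem Filter.EventuallyEq.modelDeriv_eq {f f' : P → Q} {p : P} (h : f =ᶠ[𝓝 p] f') :
    modelDeriv I I' f p = modelDeriv I I' f' p :=
  h.mfderiv_eq

theorem Filter.EventuallyEq.velocity_eq {c c' : ℝ → P} {τ : ℝ} (h : c =ᶠ[𝓝 τ] c') :
    velocity I c τ = velocity I c' τ :=
  DFunLike.congr_fun h.modelDeriv_eq 1

theorem modelDeriv_id (p : P) (v : E) : modelDeriv I I id p v = v :=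
  DFunLike.congr_fun (mfderiv_id (I := I) (x := p)) v

theorem modelDeriv_const (p : P) (q : Q) : modelDeriv I I' (fun _ : P => q) p = 0 :=
  mfderiv_const

theorem modelDeriv_eq_fderiv (f : E → E') (p : E) :
    modelDeriv 𝓘(ℝ, E) 𝓘(ℝ, E') f p = fderiv ℝ f p :=
  mfderiv_eq_fderiv

theorem velocity_eq_deriv (c : ℝ → E) (τ : ℝ) : velocity 𝓘(ℝ, E) c τ = deriv c τ := by
  rw [velocity, modelDeriv_eq_fderiv]; rfl

theorem modelDeriv_continuousLinearMap (ℓ : E →L[ℝ] E') (p : E) :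
    modelDeriv 𝓘(ℝ, E) 𝓘(ℝ, E') ℓ p = ℓ := by
  rw [modelDeriv_eq_fderiv, ℓ.fderiv]

theorem velocity_line (p v : E) (τ : ℝ) : velocity 𝓘(ℝ, E) (fun σ => p + σ • v) τ = v := by
  rw [velocity_eq_deriv]
  have := ((hasDerivAt_id τ).smul_const v).const_add p
  simpa using this.deriv

/-- A left inverse of a map gives a left inverse of its derivative. -/
theorem modelDeriv_leftInverse {f : P → Q} {f' : Q → P} {p : P} {q : Q}
    (hf : MDifferentiableAt I I' f p) (hf' : MDifferentiableAt I' I f' q) (h : f p = q)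
    (hinv : ∀ᶠ y in 𝓝 p, f' (f y) = y) (v : E) :
    modelDeriv I' I f' q (modelDeriv I I' f p v) = v := by
  rw [← modelDeriv_comp_apply hf' hf h]
  have : f' ∘ f =ᶠ[𝓝 p] id := hinv
  rw [this.modelDeriv_eq, modelDeriv_id]

end Derivative

/-! ### Submersions: local sections and curves in fibres -/

section Submersion

variable {n m : ℕ} {G M : Type*}
  [TopologicalSpace G] [ChartedSpace (EuclideanSpace ℝ (Fin n)) G]
  [TopologicalSpace M] [ChartedSpace (EuclideanSpace ℝ (Fin m)) M]

/-- Near each point, a submersion is a surjective linear map in suitable charts. -/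
theorem Manifold.IsSubmersion.exists_charts_linear {f : G → M}
    (hf : IsSubmersion (𝓡 n) (𝓡 m) ∞ f) (g : G) :
    ∃ φ ∈ IsManifold.maximalAtlas (𝓡 n) ∞ G, ∃ χ ∈ IsManifold.maximalAtlas (𝓡 m) ∞ M,
      ∃ ℓ : EuclideanSpace ℝ (Fin n) →L[ℝ] EuclideanSpace ℝ (Fin m),
        Function.Surjective ℓ ∧ g ∈ φ.source ∧ MapsTo f φ.source χ.source ∧
        ∀ h ∈ φ.source, χ (f h) = ℓ (φ h) := by
  have h := hf.isSubmersionOfComplement_complement g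
  refine ⟨h.domChart, h.domChart_mem_maximalAtlas, h.codChart, h.codChart_mem_maximalAtlas,
    (ContinuousLinearMap.fst ℝ _ hf.complement).comp
      (h.equiv : _ →L[ℝ] EuclideanSpace ℝ (Fin m) × hf.complement), ?_, h.mem_domChart_source,
    h.mapsto_domChart_source_codChart_source, fun y hy => ?_⟩
  · exact Prod.fst_surjective.comp h.equiv.surjective
  · have hm : h.domChart y ∈ (h.domChart.extend (𝓡 n)).target := by
      simpa using h.domChart.map_source hy
    have := h.writtenInCharts hm
    simpa [h.domChart.left_inv hy] using this

theorem OpenPartialHomeomorph.mdifferentiable_of_mem_maximalAtlas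
    {φ : OpenPartialHomeomorph G (EuclideanSpace ℝ (Fin n))}
    (hφ : φ ∈ IsManifold.maximalAtlas (𝓡 n) ∞ G) : φ.MDifferentiable (𝓡 n) (𝓡 n) :=
  ⟨(contMDiffOn_of_mem_maximalAtlas hφ).mdifferentiableOn (by simp),
    (contMDiffOn_symm_of_mem_maximalAtlas hφ).mdifferentiableOn (by simp)⟩

/-- A submersion has smooth local sections through every point. -/
theorem Manifold.IsSubmersion.exists_section {f : G → M}
    (hf : IsSubmersion (𝓡 n) (𝓡 m) ∞ f) (g : G) :
    ∃ σ : M → G, σ (f g) = g ∧ ContMDiffAt (𝓡 m) (𝓡 n) ∞ σ (f g) ∧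
      ∀ᶠ y in 𝓝 (f g), f (σ y) = y := by
  obtain ⟨φ, hφ, χ, hχ, ℓ, hℓ, hg, hmaps, hfℓ⟩ := hf.exists_charts_linear g
  obtain ⟨ρ, hρ⟩ := ℓ.exists_rightInverse_of_surjective (LinearMap.range_eq_top.2 hℓ)
  -- In the charts the section is affine, built from a linear right inverse of `ℓ`.
  let A : EuclideanSpace ℝ (Fin m) → EuclideanSpace ℝ (Fin n) := fun y => φ g + ρ (y - χ (f g))
  have hA : ContMDiffAt (𝓡 m) (𝓡 n) ∞ (fun y => A (χ y)) (f g) := by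
    have h1 : ContMDiff (𝓡 m) (𝓡 n) ∞ A := by
      rw [contMDiff_iff_contDiff]; fun_prop
    exact (h1 _).comp (f g) (contMDiffAt_of_mem_maximalAtlas hχ (hmaps hg))
  have hA0 : A (χ (f g)) = φ g := by simp [A]
  have hAt : A (χ (f g)) ∈ φ.target := hA0 ▸ φ.map_source hg
  refine ⟨fun y => φ.symm (A (χ y)), ?_, ?_, ?_⟩
  · simp [hA0, φ.left_inv hg]
  · exact (contMDiffAt_symm_of_mem_maximalAtlas hφ hAt).comp (f g) hA
  · filter_upwards [χ.open_source.mem_nhds (hmaps hg),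
      hA.continuousAt.preimage_mem_nhds (φ.open_target.mem_nhds hAt)] with y hy hyA
    have hs := φ.map_target hyA
    refine χ.injOn (hmaps hs) hy ?_
    rw [hfℓ _ hs, φ.right_inv hyA]
    have hρ' : ∀ z, ℓ (ρ z) = z := fun z => DFunLike.congr_fun hρ z
    simp [A, hρ', hfℓ g hg]

theorem Manifold.IsSubmersion.modelDeriv_surjective {f : G → M}
    (hf : IsSubmersion (𝓡 n) (𝓡 m) ∞ f) (g : G) :
    Function.Surjective (modelDeriv (𝓡 n) (𝓡 m) f g) := by
  obtain ⟨σ, hσg, hσ, hfσ⟩ := hf.exists_section g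
  exact fun v => ⟨_, modelDeriv_leftInverse (hσ.mdifferentiableAt (by simp))
    (hf.contMDiff.mdifferentiable (by simp) g) hσg hfσ v⟩

/-- A tangent vector in the kernel of the derivative of a submersion is the velocity of a curve
in a fibre. -/
theorem Manifold.IsSubmersion.exists_curve {f : G → M}
    (hf : IsSubmersion (𝓡 n) (𝓡 m) ∞ f) (g : G) (v : EuclideanSpace ℝ (Fin n))
    (hv : modelDeriv (𝓡 n) (𝓡 m) f g v = 0) :
    ∃ c : ℝ → G, c 0 = g ∧ ContMDiffAt 𝓘(ℝ, ℝ) (𝓡 n) ∞ c 0 ∧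
      (∀ᶠ τ in 𝓝 0, f (c τ) = f g) ∧ velocity (𝓡 n) c 0 = v := by
  obtain ⟨φ, hφ, χ, hχ, ℓ, hℓ, hg, hmaps, hfℓ⟩ := hf.exists_charts_linear g
  have hφd := OpenPartialHomeomorph.mdifferentiable_of_mem_maximalAtlas hφ
  have hχd := OpenPartialHomeomorph.mdifferentiable_of_mem_maximalAtlas hχ
  let w : EuclideanSpace ℝ (Fin n) := modelDeriv (𝓡 n) (𝓡 n) φ g v
  have hw : ℓ w = 0 := by
    have h0 : χ ∘ f =ᶠ[𝓝 g] ℓ ∘ φ := by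
      filter_upwards [φ.open_source.mem_nhds hg] with y hy using hfℓ y hy
    have h1 : modelDeriv (𝓡 n) (𝓡 m) (χ ∘ f) g v = modelDeriv (𝓡 n) (𝓡 m) (ℓ ∘ φ) g v := by
      rw [h0.modelDeriv_eq]
    rw [modelDeriv_comp_apply (hχd.mdifferentiableAt (hmaps hg))
      (hf.contMDiff.mdifferentiable (by simp) g) rfl, hv,
      modelDeriv_comp_apply ℓ.differentiableAt.mdifferentiableAt (hφd.mdifferentiableAt hg) rfl,
      modelDeriv_continuousLinearMap, map_zero] at h1
    exact h1.symm
  -- In the chart the curve is a straight line; it stays in the fibre because `ℓ w = 0`.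
  let A : ℝ → EuclideanSpace ℝ (Fin n) := fun τ => φ g + τ • w
  have hA : ContMDiff 𝓘(ℝ, ℝ) (𝓡 n) ∞ A := by
    rw [contMDiff_iff_contDiff]; fun_prop
  have hA0 : A 0 = φ g := by simp [A]
  have hAt : A 0 ∈ φ.target := hA0 ▸ φ.map_source hg
  have hev : ∀ᶠ τ in 𝓝 (0 : ℝ), A τ ∈ φ.target :=
    hA.continuous.continuousAt.preimage_mem_nhds (φ.open_target.mem_nhds hAt)
  have hc : ContMDiffAt 𝓘(ℝ, ℝ) (𝓡 n) ∞ (φ.symm ∘ A) 0 :=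
    (contMDiffAt_symm_of_mem_maximalAtlas hφ hAt).comp 0 (hA 0)
  have hc0 : (φ.symm ∘ A) 0 = g := by simp [hA0, φ.left_inv hg]
  refine ⟨φ.symm ∘ A, hc0, hc, ?_, ?_⟩
  · filter_upwards [hev] with τ hτ
    have hs := φ.map_target hτ
    refine χ.injOn (hmaps hs) (hmaps hg) ?_
    rw [hfℓ _ hs, φ.right_inv hτ, hfℓ g hg]
    simp [A, hw]
  · rw [velocity_comp (hφd.mdifferentiableAt_symm (φ.map_source hg))
      (hA.mdifferentiable (by simp) 0) hA0, velocity_line]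
    exact modelDeriv_leftInverse (hφd.mdifferentiableAt hg)
      (hφd.mdifferentiableAt_symm (φ.map_source hg)) rfl (φ.eventually_left_inverse hg) v

end Submersion

/-! ### Tangent spaces of embedded submanifolds -/

section Factor

variable {m : ℕ} {M : Type*} [TopologicalSpace M] [ChartedSpace (EuclideanSpace ℝ (Fin m)) M]

/-- The velocity of a smooth curve in `M` that lies in an embedded submanifold is tangent to it. -/
theorem EmbeddedSubmanifold.velocity_mem_tangentSpace {S : Set M} (N : EmbeddedSubmanifold m S)
    {c : ℝ → M} {τ : ℝ} (hc : ContMDiffAt 𝓘(ℝ, ℝ) (𝓡 m) ∞ c τ) (hcS : ∀ᶠ σ in 𝓝 τ, c σ ∈ S)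
    {y : S} (h : c τ = y) : velocity (𝓡 m) c τ ∈ N.tangentSpace y := by
  classical
  let _ := N.chartedSpace
  have _ := N.isManifold
  -- The default value `y` is harmless: only the germ at `τ` matters.
  let d : ℝ → S := fun σ => if hσ : c σ ∈ S then ⟨c σ, hσ⟩ else y
  have hdτ : d τ = y := by simp [d, h]
  have hdc : (Subtype.val : S → M) ∘ d =ᶠ[𝓝 τ] c := by
    filter_upwards [hcS] with σ hσ
    simp [d, hσ]
  have hc' : ContMDiffAt 𝓘(ℝ, ℝ) (𝓡 m) ∞ ((Subtype.val : S → M) ∘ d) τ :=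
    hc.congr_of_eventuallyEq hdc
  -- The embedding gives continuity of `d`, and the immersion then gives smoothness.
  have hd : ContMDiffAt 𝓘(ℝ, ℝ) (𝓡 N.dim) ∞ d τ :=
    (ContMDiffAt.iff_comp_isImmersionAt (N.isSmoothEmbedding.isImmersion.isImmersionAt _)).2
      ⟨N.isSmoothEmbedding.isEmbedding.continuousAt_iff.2 hc'.continuousAt, hc'⟩
  rw [← hdc.velocity_eq, velocity_comp
    (N.isSmoothEmbedding.contMDiff.mdifferentiable (by simp) y)
    (hd.mdifferentiableAt (by simp)) hdτ]
  exact ⟨_, rfl⟩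

theorem EmbeddedSubmanifold.finrank_tangentSpace_le {S : Set M} (N : EmbeddedSubmanifold m S)
    (y : S) : Module.finrank ℝ (N.tangentSpace y) ≤ N.dim := by
  let _ := N.chartedSpace
  have h := LinearMap.finrank_range_le
    (modelDeriv (𝓡 N.dim) (𝓡 m) (Subtype.val : S → M) y).toLinearMap
  rw [finrank_euclideanSpace_fin] at h
  exact h

end Factor

/-! ### Dimensions of images of kernels -/

section LinearAlgebra

/-- Rank-nullity for the restriction of `B` to `ker A`. -/
theorem LinearMap.finrank_map_ker_add {V W W' : Type*} [AddCommGroup V] [Module ℝ V]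
    [FiniteDimensional ℝ V] [AddCommGroup W] [Module ℝ W] [AddCommGroup W'] [Module ℝ W']
    (A : V →ₗ[ℝ] W) (B : V →ₗ[ℝ] W') :
    Module.finrank ℝ ((ker A).map B) + Module.finrank ℝ (ker A ⊓ ker B : Submodule ℝ V) =
      Module.finrank ℝ (ker A) := by
  have h := LinearMap.finrank_range_add_finrank_ker (B.domRestrict (ker A))
  rw [LinearMap.range_domRestrict] at h
  rw [← h, LinearMap.ker_domRestrict]
  congr 1
  have e := Submodule.equivSubtypeMap (ker A) ((ker B).comap (ker A).subtype)
  rw [e.finrank_eq, Submodule.map_comap_subtype]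

/-- For two surjections with the same target dimension, the images of the kernel of each under the
other have the same dimension. -/
theorem LinearMap.finrank_map_ker_comm {V W : Type*} [AddCommGroup V] [Module ℝ V]
    [FiniteDimensional ℝ V] [AddCommGroup W] [Module ℝ W]
    {A B : V →ₗ[ℝ] W} (hA : Function.Surjective A) (hB : Function.Surjective B) :
    Module.finrank ℝ ((ker A).map B) = Module.finrank ℝ ((ker B).map A) := by
  -- Both sides equal dim V - dim W - dim (ker A ∩ ker B).
  have h1 := finrank_map_ker_add A B
  have h2 := finrank_map_ker_add B A
  have h3 := LinearMap.finrank_range_add_finrank_ker A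
  have h4 := LinearMap.finrank_range_add_finrank_ker B
  rw [LinearMap.range_eq_top.2 hA] at h3
  rw [LinearMap.range_eq_top.2 hB] at h4
  rw [inf_comm] at h2
  omega

end LinearAlgebra

/-! ### Orbit directions and their dimension -/

namespace LieGroupoid

variable {n m : ℕ} {G M : Type*}
  [TopologicalSpace G] [ChartedSpace (EuclideanSpace ℝ (Fin n)) G]
  [TopologicalSpace M] [ChartedSpace (EuclideanSpace ℝ (Fin m)) M]
  (Γ : LieGroupoid n m G M)

/-- The tangent space of the orbit at `target g`, as a subspace of the model vector space. -/
noncomputable def orbitDirection (g : G) : Submodule ℝ (EuclideanSpace ℝ (Fin m)) :=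
  Γ.orbitTangentSpace g

theorem mem_orbitDirection {g : G} {w : EuclideanSpace ℝ (Fin m)} :
    w ∈ Γ.orbitDirection g ↔ ∃ v, modelDeriv (𝓡 n) (𝓡 m) Γ.source g v = 0 ∧
      modelDeriv (𝓡 n) (𝓡 m) Γ.target g v = w :=
  Iff.rfl

theorem mdifferentiableAt_source (g : G) : MDifferentiableAt (𝓡 n) (𝓡 m) Γ.source g :=
  Γ.isSubmersion_source.contMDiff.mdifferentiable (by simp) g

theorem mdifferentiableAt_target (g : G) : MDifferentiableAt (𝓡 n) (𝓡 m) Γ.target g :=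
  Γ.isSubmersion_target.contMDiff.mdifferentiable (by simp) g

/-- With the next lemma, this describes orbit directions by curves in source fibres, so that
invariance can be checked on curves. -/
theorem velocity_target_mem_orbitDirection {c : ℝ → G} {τ : ℝ} {g : G}
    (hc : ContMDiffAt 𝓘(ℝ, ℝ) (𝓡 n) ∞ c τ) (hg : c τ = g)
    (hs : ∀ᶠ σ in 𝓝 τ, Γ.source (c σ) = Γ.source g) :
    velocity (𝓡 m) (Γ.target ∘ c) τ ∈ Γ.orbitDirection g := by
  have hcd := hc.mdifferentiableAt (by simp)
  refine Γ.mem_orbitDirection.2 ⟨velocity (𝓡 n) c τ, ?_, ?_⟩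
  · rw [← velocity_comp (Γ.mdifferentiableAt_source g) hcd hg]
    have h : Γ.source ∘ c =ᶠ[𝓝 τ] fun _ => Γ.source g := hs
    rw [h.velocity_eq, velocity, modelDeriv_const]; rfl
  · rw [← velocity_comp (Γ.mdifferentiableAt_target g) hcd hg]

theorem exists_curve_of_mem_orbitDirection {g : G} {w : EuclideanSpace ℝ (Fin m)}
    (hw : w ∈ Γ.orbitDirection g) :
    ∃ c : ℝ → G, c 0 = g ∧ ContMDiffAt 𝓘(ℝ, ℝ) (𝓡 n) ∞ c 0 ∧
      (∀ᶠ τ in 𝓝 0, Γ.source (c τ) = Γ.source g) ∧ velocity (𝓡 m) (Γ.target ∘ c) 0 = w := by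
  obtain ⟨v, hv, rfl⟩ := Γ.mem_orbitDirection.1 hw
  obtain ⟨c, hc0, hc, hs, rfl⟩ := Γ.isSubmersion_source.exists_curve g v hv
  exact ⟨c, hc0, hc, hs, velocity_comp (Γ.mdifferentiableAt_target g)
    (hc.mdifferentiableAt (by simp)) hc0⟩

/-- Right translation by `h` carries one source fibre into another and leaves targets unchanged. -/
theorem orbitDirection_le_mul {g h : G} (hgh : Γ.source g = Γ.target h) :
    Γ.orbitDirection g ≤ Γ.orbitDirection (Γ.mul g h) := by
  intro w hw
  obtain ⟨c, hc0, hc, hs, rfl⟩ := Γ.exists_curve_of_mem_orbitDirection hw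
  -- Multiplication is smooth only on composable pairs, hence first within `T`, which is a
  -- neighbourhood of 0.
  let T : Set ℝ := {σ | Γ.source (c σ) = Γ.source g}
  have hmul : ContMDiffAt 𝓘(ℝ, ℝ) (𝓡 n) ∞ (fun σ => Γ.mul (c σ) h) 0 := by
    have h1 : ContMDiffWithinAt 𝓘(ℝ, ℝ) ((𝓡 n).prod (𝓡 n)) ∞ (fun σ => (c σ, h)) T 0 :=
      (hc.prodMk contMDiffAt_const).contMDiffWithinAt
    have h2 := Γ.contMDiffOn_mul (c 0, h) (by rw [hc0]; exact hgh)
    have h3 : ContMDiffWithinAt 𝓘(ℝ, ℝ) (𝓡 n) ∞ (fun σ => Γ.mul (c σ) h) T 0 :=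
      h2.comp 0 h1 fun σ hσ => (show Γ.source (c σ) = Γ.target h from hσ.trans hgh)
    exact h3.contMDiffAt hs
  have heq : Γ.target ∘ c =ᶠ[𝓝 0] Γ.target ∘ fun σ => Γ.mul (c σ) h := by
    filter_upwards [hs] with σ hσ
    exact (Γ.target_mul _ _ (hσ.trans hgh)).symm
  rw [heq.velocity_eq]
  refine Γ.velocity_target_mem_orbitDirection hmul (by rw [hc0]) ?_
  filter_upwards [hs] with σ hσ
  rw [Γ.source_mul _ _ (hσ.trans hgh), Γ.source_mul _ _ hgh]

/-- Right translation by g⁻¹h takes g to h. -/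
theorem orbitDirection_eq_of_target_eq {g h : G} (hgh : Γ.target g = Γ.target h) :
    Γ.orbitDirection g = Γ.orbitDirection h := by
  suffices H : ∀ {g h : G}, Γ.target g = Γ.target h →
      Γ.orbitDirection g ≤ Γ.orbitDirection h from le_antisymm (H hgh) (H hgh.symm)
  intro g h hgh
  have h1 : Γ.source (Γ.inv g) = Γ.target h := by rw [Γ.source_inv, hgh]
  have h2 : Γ.source g = Γ.target (Γ.mul (Γ.inv g) h) := by
    rw [Γ.target_mul _ _ h1, Γ.target_inv]
  have h3 : Γ.mul g (Γ.mul (Γ.inv g) h) = h := by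
    rw [← Γ.mul_assoc _ _ _ (Γ.target_inv g).symm h1, Γ.mul_inv, hgh, Γ.unit_mul]
  have := Γ.orbitDirection_le_mul h2
  rwa [h3] at this

/-- The derivative of inversion maps ker dt into ker ds and turns ds into dt. -/
theorem map_source_ker_le_orbitDirection_inv (g : G) :
    (LinearMap.ker (modelDeriv (𝓡 n) (𝓡 m) Γ.target g).toLinearMap).map
      (modelDeriv (𝓡 n) (𝓡 m) Γ.source g).toLinearMap ≤ Γ.orbitDirection (Γ.inv g) := by
  rintro _ ⟨v, hv, rfl⟩
  have hi : MDifferentiableAt (𝓡 n) (𝓡 n) Γ.inv g := Γ.contMDiff_inv.mdifferentiable (by simp) g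
  refine Γ.mem_orbitDirection.2 ⟨modelDeriv (𝓡 n) (𝓡 n) Γ.inv g v, ?_, ?_⟩
  · rw [← modelDeriv_comp_apply (Γ.mdifferentiableAt_source _) hi rfl,
      show Γ.source ∘ Γ.inv = Γ.target from funext Γ.source_inv]
    exact hv
  · rw [← modelDeriv_comp_apply (Γ.mdifferentiableAt_target _) hi rfl,
      show Γ.target ∘ Γ.inv = Γ.source from funext Γ.target_inv]
    rfl

theorem finrank_orbitDirection_le_inv (g : G) :
    Module.finrank ℝ (Γ.orbitDirection g) ≤ Module.finrank ℝ (Γ.orbitDirection (Γ.inv g)) := by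
  have h := LinearMap.finrank_map_ker_comm
    (A := (modelDeriv (𝓡 n) (𝓡 m) Γ.source g).toLinearMap)
    (B := (modelDeriv (𝓡 n) (𝓡 m) Γ.target g).toLinearMap)
    (Γ.isSubmersion_source.modelDeriv_surjective g) (Γ.isSubmersion_target.modelDeriv_surjective g)
  exact h.trans_le (Submodule.finrank_mono (Γ.map_source_ker_le_orbitDirection_inv g))

/-- The orbit has the same dimension at both ends of an arrow. -/
theorem finrank_orbitDirection_eq (g : G) :
    Module.finrank ℝ (Γ.orbitDirection g) =
      Module.finrank ℝ (Γ.orbitDirection (Γ.unit (Γ.source g))) := by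
  rw [Γ.orbitDirection_eq_of_target_eq (g := Γ.unit (Γ.source g)) (h := Γ.inv g)
    (by rw [Γ.target_unit, Γ.target_inv])]
  -- The reverse inequality is the same one at `inv g`, since `inv (inv g)` and `g` have equal
  -- targets.
  refine le_antisymm (Γ.finrank_orbitDirection_le_inv g) ?_
  refine (Γ.finrank_orbitDirection_le_inv _).trans_eq ?_
  rw [Γ.orbitDirection_eq_of_target_eq (g := Γ.inv (Γ.inv g)) (h := g)
    (by rw [Γ.target_inv, Γ.source_inv])]

end LieGroupoid

/-! ### Inverse function theorem and adapted linear lifts -/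

section InverseFunction

/-- The inverse function theorem, with smoothness of the local inverse on the whole target. -/
theorem ContDiffOn.exists_openPartialHomeomorph {X Y : Type*} [NormedAddCommGroup X]
    [NormedSpace ℝ X] [CompleteSpace X] [NormedAddCommGroup Y] [NormedSpace ℝ Y]
    {f : X → Y} {U : Set X} (hU : IsOpen U) (hf : ContDiffOn ℝ ∞ f U) {x : X} (hx : x ∈ U)
    {e : X ≃L[ℝ] Y} (he : HasFDerivAt f (e : X →L[ℝ] Y) x) :
    ∃ Ψ : OpenPartialHomeomorph X Y, x ∈ Ψ.source ∧ Ψ.source ⊆ U ∧ (∀ u, Ψ u = f u) ∧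
      ContDiffOn ℝ ∞ Ψ.symm Ψ.target := by
  have hfx : ContDiffAt ℝ ∞ f x := hf.contDiffAt (hU.mem_nhds hx)
  -- Restricting to the open set where the derivative is invertible makes the inverse smooth at
  -- every point of the target.
  have hV : IsOpen (U ∩ fderiv ℝ f ⁻¹' range ((↑) : (X ≃L[ℝ] Y) → X →L[ℝ] Y)) :=
    (hf.continuousOn_fderiv_of_isOpen hU (by simp)).isOpen_inter_preimage hU
      ContinuousLinearEquiv.isOpen
  let Ψ₀ := hfx.toOpenPartialHomeomorph f he (by simp)
  refine ⟨Ψ₀.restrOpen _ hV, ⟨hfx.mem_toOpenPartialHomeomorph_source he (by simp), hx, e,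
    he.fderiv.symm⟩, fun u hu => hu.2.1, fun u => rfl, fun w hw => ?_⟩
  have hu := (Ψ₀.restrOpen _ hV).map_target hw
  obtain ⟨hu0, huU, e', he'⟩ := hu
  have hfu : ContDiffAt ℝ ∞ f ((Ψ₀.restrOpen _ hV).symm w) := hf.contDiffAt (hU.mem_nhds huU)
  refine ((Ψ₀.restrOpen _ hV).contDiffAt_symm hw (f₀' := e') ?_ hfu).contDiffWithinAt
  rw [he']
  exact (hfu.differentiableAt (by simp)).hasFDerivAt

/-- Given a surjection `A` and a subspace `K` whose image has dimension `k`, there is a linear map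
into the domain that, followed by `A`, is an isomorphism, and whose restriction to the first factor
takes values in `K`. -/
theorem LinearMap.exists_adapted_lift {V W : Type*} [AddCommGroup V] [Module ℝ V]
    [AddCommGroup W] [Module ℝ W] [FiniteDimensional ℝ W]
    {A : V →ₗ[ℝ] W} (hA : Function.Surjective A) (K : Submodule ℝ V) {k j : ℕ}
    (hk : Module.finrank ℝ (K.map A) = k) (hj : Module.finrank ℝ W = k + j) :
    ∃ L : EuclideanSpace ℝ (Fin k) × EuclideanSpace ℝ (Fin j) →ₗ[ℝ] V,
      (∀ b, L (b, 0) ∈ K) ∧ Function.Bijective (A ∘ₗ L) := by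
  obtain ⟨C, hC⟩ := (K.map A).exists_isCompl
  have hCj : Module.finrank ℝ C = j := by
    have := Submodule.finrank_add_eq_of_isCompl hC
    omega
  let eT : EuclideanSpace ℝ (Fin k) ≃ₗ[ℝ] K.map A := LinearEquiv.ofFinrankEq _ _ (by simp [hk])
  let eC : EuclideanSpace ℝ (Fin j) ≃ₗ[ℝ] C := LinearEquiv.ofFinrankEq _ _ (by simp [hCj])
  obtain ⟨r, hr⟩ := A.exists_rightInverse_of_surjective (LinearMap.range_eq_top.2 hA)
  obtain ⟨q, hq⟩ := (A.submoduleMap K).exists_rightInverse_of_surjective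
    (LinearMap.range_eq_top.2 (A.submoduleMap_surjective K))
  -- The first factor is lifted into `K`; the complement `C` of `K.map A` is lifted by an arbitrary
  -- right inverse of `A`.
  refine ⟨(K.subtype ∘ₗ q ∘ₗ eT.toLinearMap).coprod (r ∘ₗ C.subtype ∘ₗ eC.toLinearMap),
    fun b => by simp, ?_⟩
  have heq : ∀ u, (A ∘ₗ (K.subtype ∘ₗ q ∘ₗ eT.toLinearMap).coprod
      (r ∘ₗ C.subtype ∘ₗ eC.toLinearMap)) u =
        ((eT.prodCongr eC).trans (Submodule.prodEquivOfIsCompl _ _ hC)) u := by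
    rintro ⟨b, a⟩
    have h1 : A (q (eT b)) = eT b := congrArg Subtype.val (DFunLike.congr_fun hq (eT b))
    have h2 : A (r (eC a)) = eC a := DFunLike.congr_fun hr _
    simp [h1, h2]
  rw [show ⇑(A ∘ₗ (K.subtype ∘ₗ q ∘ₗ eT.toLinearMap).coprod
      (r ∘ₗ C.subtype ∘ₗ eC.toLinearMap)) = _ from funext heq]
  exact LinearEquiv.bijective _

end InverseFunction

/-! ### Derivatives of charts -/

section Charts

variable {n m : ℕ} {G M : Type*}
  [TopologicalSpace G] [ChartedSpace (EuclideanSpace ℝ (Fin n)) G]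
  [TopologicalSpace M] [ChartedSpace (EuclideanSpace ℝ (Fin m)) M]

theorem modelDeriv_symm_apply {φ : OpenPartialHomeomorph G (EuclideanSpace ℝ (Fin n))}
    (hφ : φ ∈ IsManifold.maximalAtlas (𝓡 n) ∞ G) {g : G} (hg : g ∈ φ.source)
    (v : EuclideanSpace ℝ (Fin n)) :
    modelDeriv (𝓡 n) (𝓡 n) φ.symm (φ g) (modelDeriv (𝓡 n) (𝓡 n) φ g v) = v := by
  have hφd := OpenPartialHomeomorph.mdifferentiable_of_mem_maximalAtlas hφ
  exact modelDeriv_leftInverse (hφd.mdifferentiableAt hg)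
      (hφd.mdifferentiableAt_symm (φ.map_source hg)) rfl (φ.eventually_left_inverse hg) v

theorem modelDeriv_apply_symm {φ : OpenPartialHomeomorph G (EuclideanSpace ℝ (Fin n))}
    (hφ : φ ∈ IsManifold.maximalAtlas (𝓡 n) ∞ G) {g : G} (hg : g ∈ φ.source)
    (v : EuclideanSpace ℝ (Fin n)) :
    modelDeriv (𝓡 n) (𝓡 n) φ g (modelDeriv (𝓡 n) (𝓡 n) φ.symm (φ g) v) = v := by
  have hφd := OpenPartialHomeomorph.mdifferentiable_of_mem_maximalAtlas hφ
  exact modelDeriv_leftInverse (hφd.mdifferentiableAt_symm (φ.map_source hg))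
    (hφd.mdifferentiableAt hg) (φ.left_inv hg)
    (φ.eventually_right_inverse (φ.map_source hg)) v

/-- In charts in which `f` is linear, the kernel of the derivative is the kernel of that linear
map. -/
theorem modelDeriv_eq_zero_iff_of_charts {f : G → M} {g : G}
    (hf : MDifferentiableAt (𝓡 n) (𝓡 m) f g)
    {φ : OpenPartialHomeomorph G (EuclideanSpace ℝ (Fin n))}
    (hφ : φ ∈ IsManifold.maximalAtlas (𝓡 n) ∞ G)
    {χ : OpenPartialHomeomorph M (EuclideanSpace ℝ (Fin m))}
    (hχ : χ ∈ IsManifold.maximalAtlas (𝓡 m) ∞ M)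
    {ℓ : EuclideanSpace ℝ (Fin n) →L[ℝ] EuclideanSpace ℝ (Fin m)}
    (hg : g ∈ φ.source) (hfg : f g ∈ χ.source)
    (hfℓ : ∀ h ∈ φ.source, χ (f h) = ℓ (φ h)) (v : EuclideanSpace ℝ (Fin n)) :
    modelDeriv (𝓡 n) (𝓡 m) f g v = 0 ↔ ℓ (modelDeriv (𝓡 n) (𝓡 n) φ g v) = 0 := by
  have hφd := OpenPartialHomeomorph.mdifferentiable_of_mem_maximalAtlas hφ
  have hχd := OpenPartialHomeomorph.mdifferentiable_of_mem_maximalAtlas hχ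
  have h0 : χ ∘ f =ᶠ[𝓝 g] ℓ ∘ φ := by
    filter_upwards [φ.open_source.mem_nhds hg] with y hy using hfℓ y hy
  have h1 : modelDeriv (𝓡 n) (𝓡 m) (χ ∘ f) g v = modelDeriv (𝓡 n) (𝓡 m) (ℓ ∘ φ) g v := by
    rw [h0.modelDeriv_eq]
  rw [modelDeriv_comp_apply (hχd.mdifferentiableAt hfg) hf rfl,
    modelDeriv_comp_apply ℓ.differentiableAt.mdifferentiableAt (hφd.mdifferentiableAt hg) rfl,
    modelDeriv_continuousLinearMap] at h1
  rw [← h1]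
  refine ⟨fun h => by rw [h, map_zero], fun h => ?_⟩
  have := modelDeriv_symm_apply hχ hfg (modelDeriv (𝓡 n) (𝓡 m) f g v)
  rw [← this, h, map_zero]

end Charts

/-! ### Orbit boxes: construction -/

namespace LieGroupoid

variable {n m : ℕ} {G M : Type*}
  [TopologicalSpace G] [ChartedSpace (EuclideanSpace ℝ (Fin n)) G]
  [TopologicalSpace M] [ChartedSpace (EuclideanSpace ℝ (Fin m)) M]

/-- A chart of `M` centred at `y`, with values in a ball of a product, together with a smooth family
of arrows showing that each plaque (the second coordinate being fixed) lies in one orbit. -/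
structure OrbitBox (Γ : LieGroupoid n m G M) (k j : ℕ) (y : M) where
  chart : OpenPartialHomeomorph M (EuclideanSpace ℝ (Fin k) × EuclideanSpace ℝ (Fin j))
  radius : ℝ
  radius_pos : 0 < radius
  chart_target : chart.target = Metric.ball 0 radius
  mem_source : y ∈ chart.source
  chart_self : chart y = 0
  contMDiffOn_chart :
    ContMDiffOn (𝓡 m) 𝓘(ℝ, EuclideanSpace ℝ (Fin k) × EuclideanSpace ℝ (Fin j)) ∞
      chart chart.source
  contMDiffOn_symm :
    ContMDiffOn 𝓘(ℝ, EuclideanSpace ℝ (Fin k) × EuclideanSpace ℝ (Fin j)) (𝓡 m) ∞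
      chart.symm chart.target
  arrow : EuclideanSpace ℝ (Fin k) × EuclideanSpace ℝ (Fin j) → G
  contMDiffOn_arrow :
    ContMDiffOn 𝓘(ℝ, EuclideanSpace ℝ (Fin k) × EuclideanSpace ℝ (Fin j)) (𝓡 n) ∞
      arrow chart.target
  target_arrow : ∀ u ∈ chart.target, Γ.target (arrow u) = chart.symm u
  source_arrow : ∀ u ∈ chart.target, ∀ v ∈ chart.target, u.2 = v.2 →
    Γ.source (arrow u) = Γ.source (arrow v)

/-- Shrinking an orbit box to a smaller ball. -/
noncomputable def OrbitBox.shrink {Γ : LieGroupoid n m G M} {k j : ℕ} {y : M} (B : Γ.OrbitBox k j y)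
    (r : ℝ) (hr : 0 < r) (hrB : r ≤ B.radius) : Γ.OrbitBox k j y where
  -- `restrOpen` cuts down the source, so the inverse chart is restricted and inverted back.
  chart := (B.chart.symm.restrOpen (Metric.ball 0 r) Metric.isOpen_ball).symm
  radius := r
  radius_pos := hr
  chart_target := by
    have : Metric.ball 0 r ⊆ B.chart.target := by
      rw [B.chart_target]; exact Metric.ball_subset_ball hrB
    simpa using this
  mem_source := by
    have h := B.mem_source
    simp [h, B.chart_self, hr]
  chart_self := B.chart_self
  contMDiffOn_chart := B.contMDiffOn_chart.mono fun z hz => by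
    simp at hz; exact hz.1
  contMDiffOn_symm := B.contMDiffOn_symm.mono fun z hz => hz.1
  arrow := B.arrow
  contMDiffOn_arrow := B.contMDiffOn_arrow.mono fun z hz => hz.1
  target_arrow := fun u hu => B.target_arrow u hu.1
  source_arrow := fun u hu v hv => B.source_arrow u hu.1 v hv.1

variable (Γ : LieGroupoid n m G M) [IsManifold (𝓡 m) ∞ M]

/-- In a chart where the source is the linear map `ℓ`, take an affine family of arrows through `g`
whose first k directions lie in `ker ℓ` and on which the derivative of the target is invertible. The
box is the local inverse of the target on this family. -/
theorem nonempty_orbitBox (g : G) {k j : ℕ} (hk : Module.finrank ℝ (Γ.orbitDirection g) = k)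
    (hj : m = k + j) : Nonempty (Γ.OrbitBox k j (Γ.target g)) := by
  obtain ⟨φ, hφ, χ, hχ, ℓ, hℓ, hg, hmaps, hsℓ⟩ := Γ.isSubmersion_source.exists_charts_linear g
  have hφd := OpenPartialHomeomorph.mdifferentiable_of_mem_maximalAtlas hφ
  have hφs := hφd.mdifferentiableAt_symm (φ.map_source hg)
  let θ := chartAt (EuclideanSpace ℝ (Fin m)) (Γ.target g)
  have hθ : θ ∈ IsManifold.maximalAtlas (𝓡 m) ∞ M := IsManifold.chart_mem_maximalAtlas _
  have hθg : Γ.target g ∈ θ.source := mem_chart_source _ _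
  have hθd := OpenPartialHomeomorph.mdifferentiable_of_mem_maximalAtlas hθ
  let D : EuclideanSpace ℝ (Fin n) →L[ℝ] EuclideanSpace ℝ (Fin m) :=
    modelDeriv (𝓡 n) (𝓡 m) (Γ.target ∘ φ.symm) (φ g)
  have hD : ∀ u, D u = modelDeriv (𝓡 n) (𝓡 m) Γ.target g
      (modelDeriv (𝓡 n) (𝓡 n) φ.symm (φ g) u) := fun u =>
    modelDeriv_comp_apply (Γ.mdifferentiableAt_target g) hφs (φ.left_inv hg) u
  have hDsurj : Function.Surjective D := fun w => by
    obtain ⟨v, hv⟩ := Γ.isSubmersion_target.modelDeriv_surjective g w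
    exact ⟨modelDeriv (𝓡 n) (𝓡 n) φ g v, by rw [hD, modelDeriv_symm_apply hφ hg, hv]⟩
  have hker : ∀ v, modelDeriv (𝓡 n) (𝓡 m) Γ.source g v = 0 ↔
      ℓ (modelDeriv (𝓡 n) (𝓡 n) φ g v) = 0 :=
    modelDeriv_eq_zero_iff_of_charts (Γ.mdifferentiableAt_source g) hφ hχ hg (hmaps hg) hsℓ
  have hmap : (LinearMap.ker ℓ.toLinearMap).map D.toLinearMap = Γ.orbitDirection g := by
    ext w
    rw [Γ.mem_orbitDirection]
    constructor
    · rintro ⟨u, hu, rfl⟩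
      refine ⟨modelDeriv (𝓡 n) (𝓡 n) φ.symm (φ g) u, ?_, (hD u).symm⟩
      rw [hker, modelDeriv_apply_symm hφ hg]
      exact hu
    · rintro ⟨v, hv, rfl⟩
      exact ⟨_, (hker v).1 hv, (hD _).trans (by rw [modelDeriv_symm_apply hφ hg])⟩
  obtain ⟨L, hLK, hLbij⟩ := LinearMap.exists_adapted_lift (A := D.toLinearMap) hDsurj
    (LinearMap.ker ℓ.toLinearMap) (k := k) (j := j) (by rw [hmap, hk]) (by simp [hj])
  let Lc := LinearMap.toContinuousLinearMap L
  let a : EuclideanSpace ℝ (Fin k) × EuclideanSpace ℝ (Fin j) → EuclideanSpace ℝ (Fin n) :=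
    fun u => φ g + Lc u
  have ha : ContDiff ℝ ∞ a := by fun_prop
  have ha0 : a 0 = φ g := by simp [a]
  let W := φ.target ∩ φ.symm ⁻¹' (Γ.target ⁻¹' θ.source)
  have hW : IsOpen W := φ.symm.isOpen_inter_preimage
    (θ.open_source.preimage Γ.isSubmersion_target.contMDiff.continuous)
  have hgW : φ g ∈ W := ⟨φ.map_source hg, by simpa [φ.left_inv hg] using hθg⟩
  let f : EuclideanSpace ℝ (Fin n) → EuclideanSpace ℝ (Fin m) := θ ∘ Γ.target ∘ φ.symm
  have hf : ContDiffOn ℝ ∞ f W := by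
    rw [← contMDiffOn_iff_contDiffOn]
    exact (contMDiffOn_of_mem_maximalAtlas hθ).comp
      (Γ.isSubmersion_target.contMDiff.comp_contMDiffOn
        ((contMDiffOn_symm_of_mem_maximalAtlas hφ).mono inter_subset_left)) inter_subset_right
  have hfD : ∀ u, fderiv ℝ f (φ g) u = modelDeriv (𝓡 m) (𝓡 m) θ (Γ.target g) (D u) := fun u => by
    rw [← modelDeriv_eq_fderiv]
    exact modelDeriv_comp_apply (hθd.mdifferentiableAt hθg)
      ((Γ.mdifferentiableAt_target _).comp _ hφs) (by simp [φ.left_inv hg]) u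
  have hbij : Function.Bijective ((fderiv ℝ f (φ g)).comp Lc) := by
    have h1 : Function.Bijective (modelDeriv (𝓡 m) (𝓡 m) θ (Γ.target g)) :=
      ⟨Function.LeftInverse.injective (modelDeriv_symm_apply hθ hθg),
        Function.RightInverse.surjective (modelDeriv_apply_symm hθ hθg)⟩
    have h2 := h1.comp hLbij
    convert! h2 using 1
    ext u : 1
    exact hfD (L u)
  let e := (LinearEquiv.ofBijective ((fderiv ℝ f (φ g)).comp Lc).toLinearMap
    hbij).toContinuousLinearEquiv
  have hfa : HasFDerivAt (f ∘ a) (e : _ →L[ℝ] EuclideanSpace ℝ (Fin m)) 0 := by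
    have h1 : HasFDerivAt f (fderiv ℝ f (φ g)) (a 0) := by
      rw [ha0]
      exact ((hf.contDiffAt (hW.mem_nhds hgW)).differentiableAt (by simp)).hasFDerivAt
    have h2 : HasFDerivAt a Lc 0 := (Lc.hasFDerivAt).const_add _
    convert! h1.comp 0 h2 using 1
  obtain ⟨Ψ, h0Ψ, hΨU, hΨf, hΨsymm⟩ := ContDiffOn.exists_openPartialHomeomorph
    (hW.preimage ha.continuous) (hf.comp ha.contDiffOn (fun _ h => h))
    (show (0 : _) ∈ a ⁻¹' W by rw [mem_preimage, ha0]; exact hgW) hfa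
  have hθΨ : θ (Γ.target g) = Ψ 0 := by
    rw [hΨf]; simp [f, ha0, φ.left_inv hg]
  -- Since `Ψ` is `θ ∘ Γ.target ∘ φ.symm ∘ a`, the chart `ψ` locally inverts `u ↦ Γ.target (φ.symm
  -- (a u))`.
  let ψ := θ.trans Ψ.symm
  have hψ0 : ψ (Γ.target g) = 0 := by
    change Ψ.symm (θ (Γ.target g)) = 0
    rw [hθΨ, Ψ.left_inv h0Ψ]
  have hψg : Γ.target g ∈ ψ.source := by
    simp only [ψ, OpenPartialHomeomorph.trans_source]
    exact ⟨hθg, by rw [mem_preimage, hθΨ]; exact Ψ.map_source h0Ψ⟩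
  have h0t : (0 : _) ∈ ψ.target := hψ0 ▸ ψ.map_source hψg
  have htΨ : ψ.target ⊆ Ψ.source := fun u hu => by
    simp only [ψ, OpenPartialHomeomorph.trans_target] at hu; exact hu.1
  have hΨs : ContDiffOn ℝ ∞ Ψ Ψ.source :=
    ((hf.comp ha.contDiffOn (fun _ h => h)).mono hΨU).congr fun u _ => hΨf u
  obtain ⟨r, hr, hrt⟩ := Metric.isOpen_iff.1 ψ.open_target 0 h0t
  have hψ1 : ContMDiffOn (𝓡 m) 𝓘(ℝ, EuclideanSpace ℝ (Fin k) × EuclideanSpace ℝ (Fin j)) ∞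
      ψ ψ.source := by
    refine (contMDiffOn_iff_contDiffOn.2 hΨsymm).comp
      ((contMDiffOn_of_mem_maximalAtlas hθ).mono fun z hz => ?_) fun z hz => ?_
    · simp only [ψ, OpenPartialHomeomorph.trans_source] at hz; exact hz.1
    · simp only [ψ, OpenPartialHomeomorph.trans_source] at hz; exact hz.2
  have hψ2 : ContMDiffOn 𝓘(ℝ, EuclideanSpace ℝ (Fin k) × EuclideanSpace ℝ (Fin j)) (𝓡 m) ∞
      ψ.symm ψ.target := by
    refine (contMDiffOn_symm_of_mem_maximalAtlas hθ).comp
      ((contMDiffOn_iff_contDiffOn.2 hΨs).mono htΨ) fun z hz => ?_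
    simp only [ψ, OpenPartialHomeomorph.trans_target] at hz; exact hz.2
  refine ⟨{
    chart := (ψ.symm.restrOpen (Metric.ball 0 r) Metric.isOpen_ball).symm
    radius := r
    radius_pos := hr
    chart_target := by simpa using hrt
    mem_source := ?_
    chart_self := hψ0
    contMDiffOn_chart := hψ1.mono fun z hz => ?_
    contMDiffOn_symm := hψ2.mono fun z hz => hz.1
    arrow := φ.symm ∘ a
    contMDiffOn_arrow := ?_
    target_arrow := fun u hu => ?_
    source_arrow := fun u hu v hv huv => ?_ }⟩
  · simp [hψg, hψ0, hr]
  · simp at hz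
    exact hz.1
  · refine (contMDiffOn_symm_of_mem_maximalAtlas hφ).comp
      (contMDiffOn_iff_contDiffOn.2 ha.contDiffOn) fun u hu => ?_
    exact (hΨU (htΨ hu.1)).1
  · have h1 := htΨ hu.1
    change _ = θ.symm (Ψ u)
    rw [hΨf]
    exact (θ.left_inv (hΨU h1).2).symm
  · have h1 := (hΨU (htΨ hu.1)).1
    have h2 := (hΨU (htΨ hv.1)).1
    refine χ.injOn (hmaps (φ.map_target h1)) (hmaps (φ.map_target h2)) ?_
    change χ (Γ.source (φ.symm (a u))) = χ (Γ.source (φ.symm (a v)))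
    rw [hsℓ _ (φ.map_target h1), hsℓ _ (φ.map_target h2), φ.right_inv h1, φ.right_inv h2]
    -- With equal second coordinates, `u - v` lies in the first factor, which `L` sends into `ker
    -- ℓ`.
    have h3 : ℓ (L (u - v)) = 0 := by
      have : u - v = (u.1 - v.1, 0) := Prod.ext rfl (by simp [huv])
      rw [this]
      exact hLK _
    rw [map_sub, map_sub, sub_eq_zero] at h3
    simp [a, Lc, h3]

end LieGroupoid

/-! ### Consequences of properness -/

namespace LieGroupoid

variable {n m : ℕ} {G M : Type*}
  [TopologicalSpace G] [ChartedSpace (EuclideanSpace ℝ (Fin n)) G]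
  [TopologicalSpace M] [ChartedSpace (EuclideanSpace ℝ (Fin m)) M]
  (Γ : LieGroupoid n m G M)

section Proper

theorem continuous_source : Continuous Γ.source := Γ.isSubmersion_source.contMDiff.continuous

theorem continuous_target : Continuous Γ.target := Γ.isSubmersion_target.contMDiff.continuous

variable [T2Space M]

/-- If the groupoid is proper at `x`, then the target map from the source fibre of `x` is proper
over the orbit of `x`. -/
theorem IsProperAt.exists_subseq_tendsto {Γ : LieGroupoid n m G M} {x : M} (hx : Γ.IsProperAt x)
    {h : ℕ → G} (hs : ∀ i, Γ.source (h i) = x) {g : G} (hg : Γ.source g = x)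
    (ht : Tendsto (fun i => Γ.target (h i)) atTop (𝓝 (Γ.target g))) :
    ∃ (a : G) (φ : ℕ → ℕ), StrictMono φ ∧ Tendsto (h ∘ φ) atTop (𝓝 a) ∧
      Γ.source a = x ∧ Γ.target a = Γ.target g := by
  obtain ⟨σ, hσg, hσ, hσt⟩ := Γ.isSubmersion_target.exists_section g
  obtain ⟨N, hN⟩ := eventually_atTop.1 (ht.eventually hσt)
  -- The shift by `N` makes the targets of `k i` and `h (i + N)` agree for all `i`.
  let k : ℕ → G := fun i => σ (Γ.target (h (i + N)))
  have hkt : ∀ i, Γ.target (k i) = Γ.target (h (i + N)) := fun i => hN _ (Nat.le_add_left _ _)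
  have hshift : Tendsto (fun i => i + N) atTop atTop := tendsto_add_atTop_nat N
  have hk : Tendsto k atTop (𝓝 g) := by
    have := hσ.continuousAt.tendsto.comp (ht.comp hshift)
    rwa [hσg] at this
  have hinv : ∀ i, Γ.source (Γ.inv (k i)) = Γ.target (h (i + N)) := fun i => by
    rw [Γ.source_inv, hkt]
  obtain ⟨b, φ, hφ, hb⟩ := hx (fun i => Γ.mul (Γ.inv (k i)) (h (i + N))) (by
    refine Tendsto.prodMk_nhds ?_ ?_
    · simp only [Γ.source_mul _ _ (hinv _), hs]
      exact tendsto_const_nhds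
    · simp only [Γ.target_mul _ _ (hinv _), Γ.target_inv]
      rw [← hg]
      exact (Γ.continuous_source.tendsto g).comp hk)
  -- The limits remain composable because M is Hausdorff.
  have hbt : Γ.source g = Γ.target b := by
    refine tendsto_nhds_unique ((Γ.continuous_source.tendsto g).comp (hk.comp hφ.tendsto_atTop))
      (((Γ.continuous_target.tendsto b).comp hb).congr fun i => ?_)
    simp only [Function.comp]
    rw [Γ.target_mul _ _ (hinv _), Γ.target_inv]
  have hcomp : ∀ i, Γ.source (k i) = Γ.target (Γ.mul (Γ.inv (k i)) (h (i + N))) := fun i => by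
    rw [Γ.target_mul _ _ (hinv _), Γ.target_inv]
  have hlim : Tendsto (fun i => Γ.mul (k (φ i)) (Γ.mul (Γ.inv (k (φ i))) (h (φ i + N)))) atTop
      (𝓝 (Γ.mul g b)) := by
    have hc := Γ.contMDiffOn_mul.continuousOn (g, b) hbt
    exact hc.tendsto.comp (tendsto_nhdsWithin_iff.2
      ⟨(hk.comp hφ.tendsto_atTop).prodMk_nhds hb, Eventually.of_forall fun i => hcomp _⟩)
  have hmul : ∀ i, Γ.mul (k i) (Γ.mul (Γ.inv (k i)) (h (i + N))) = h (i + N) := fun i => by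
    rw [← Γ.mul_assoc _ _ _ (Γ.target_inv _).symm (hinv i), Γ.mul_inv, hkt, Γ.unit_mul]
  simp only [hmul] at hlim
  refine ⟨Γ.mul g b, fun i => φ i + N, fun i j hij => Nat.add_lt_add_right (hφ hij) N, hlim, ?_, ?_⟩
  · exact tendsto_nhds_unique ((Γ.continuous_source.tendsto _).comp hlim)
      (tendsto_const_nhds.congr fun i => (hs _).symm)
  · exact Γ.target_mul _ _ hbt

/-- If the groupoid is proper at `x`, then the subspace topology of the orbit of `x` is the quotient
topology from the source fibre. -/
theorem IsProperAt.isQuotientMap_orbitMap [SecondCountableTopology M]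
    {Γ : LieGroupoid n m G M} {x : M} (hx : Γ.IsProperAt x) : IsQuotientMap (Γ.orbitMap x) := by
  have hcont : Continuous (Γ.orbitMap x) :=
    (Γ.continuous_target.comp continuous_subtype_val).subtype_mk _
  have hsurj : Function.Surjective (Γ.orbitMap x) := by
    rintro ⟨y, g, hg, rfl⟩
    exact ⟨⟨g, hg⟩, rfl⟩
  -- A continuous closed surjection is a quotient map; second countability of M lets sequences test
  -- closedness.
  refine IsClosedMap.isQuotientMap (fun C hC => IsSeqClosed.isClosed ?_) hcont hsurj
  intro y y₀ hy hlim
  choose h hhC hhy using hy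
  obtain ⟨g, rfl⟩ := hsurj y₀
  obtain ⟨a, φ, hφ, ha, has, hat⟩ := hx.exists_subseq_tendsto (h := fun i => (h i : G))
    (fun i => (h i).2) (g := g) g.2 (by
      have := (continuous_subtype_val.tendsto _).comp hlim
      refine this.congr fun i => ?_
      simp only [Function.comp, ← hhy]
      rfl)
  refine ⟨⟨a, has⟩, hC.mem_of_tendsto (b := atTop) (f := fun i => h (φ i))
    (tendsto_subtype_rng.2 ha) (Eventually.of_forall fun i => hhC _), Subtype.ext hat⟩

end Proper

/-! ### Plaques versus orbits -/

namespace OrbitBox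

variable {Γ} {k j : ℕ} {y : M} (B : Γ.OrbitBox k j y)

theorem mdifferentiableAt_chart {z : M} (hz : z ∈ B.chart.source) :
    MDifferentiableAt (𝓡 m) 𝓘(ℝ, EuclideanSpace ℝ (Fin k) × EuclideanSpace ℝ (Fin j))
      B.chart z :=
  (B.contMDiffOn_chart.contMDiffAt (B.chart.open_source.mem_nhds hz)).mdifferentiableAt (by simp)

theorem mdifferentiableAt_symm {u : EuclideanSpace ℝ (Fin k) × EuclideanSpace ℝ (Fin j)}
    (hu : u ∈ B.chart.target) :
    MDifferentiableAt 𝓘(ℝ, EuclideanSpace ℝ (Fin k) × EuclideanSpace ℝ (Fin j)) (𝓡 m)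
      B.chart.symm u :=
  (B.contMDiffOn_symm.contMDiffAt (B.chart.open_target.mem_nhds hu)).mdifferentiableAt (by simp)

theorem eventually_line_mem {u : EuclideanSpace ℝ (Fin k) × EuclideanSpace ℝ (Fin j)}
    (hu : u ∈ B.chart.target) (v : EuclideanSpace ℝ (Fin k) × EuclideanSpace ℝ (Fin j)) :
    ∀ᶠ τ : ℝ in 𝓝 0, u + τ • v ∈ B.chart.target := by
  have hl : ContinuousAt (fun τ : ℝ => u + τ • v) 0 := by fun_prop
  exact hl.preimage_mem_nhds (B.chart.open_target.mem_nhds (by simpa using hu))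

/-- The velocity of the coordinate line through a point of an orbit box. -/
theorem velocity_symm_line {u : EuclideanSpace ℝ (Fin k) × EuclideanSpace ℝ (Fin j)}
    (hu : u ∈ B.chart.target) (v : EuclideanSpace ℝ (Fin k) × EuclideanSpace ℝ (Fin j)) :
    velocity (𝓡 m) (B.chart.symm ∘ fun τ : ℝ => u + τ • v) 0 =
      modelDeriv 𝓘(ℝ, EuclideanSpace ℝ (Fin k) × EuclideanSpace ℝ (Fin j)) (𝓡 m)
        B.chart.symm u v := by
  have hl : DifferentiableAt ℝ (fun τ : ℝ => u + τ • v) 0 := by fun_prop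
  rw [velocity_comp (B.mdifferentiableAt_symm hu) hl.mdifferentiableAt (by simp), velocity_line]

/-- The plaques of an orbit box are tangent to the orbits. -/
theorem modelDeriv_symm_mem_orbitDirection
    {u : EuclideanSpace ℝ (Fin k) × EuclideanSpace ℝ (Fin j)} (hu : u ∈ B.chart.target)
    (b : EuclideanSpace ℝ (Fin k)) :
    modelDeriv 𝓘(ℝ, EuclideanSpace ℝ (Fin k) × EuclideanSpace ℝ (Fin j)) (𝓡 m)
      B.chart.symm u (b, 0) ∈ Γ.orbitDirection (B.arrow u) := by
  have hline := B.eventually_line_mem hu (b, 0)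
  have hc : ContMDiffAt 𝓘(ℝ, ℝ) (𝓡 n) ∞
      (B.arrow ∘ fun τ : ℝ => u + τ • ((b, 0) : _ × EuclideanSpace ℝ (Fin j))) 0 := by
    have hl : ContDiffAt ℝ ∞
        (fun τ : ℝ => u + τ • ((b, 0) : _ × EuclideanSpace ℝ (Fin j))) 0 := by fun_prop
    exact ContMDiffAt.comp (0 : ℝ) (B.contMDiffOn_arrow.contMDiffAt
      (B.chart.open_target.mem_nhds (by simpa using hu))) hl.contMDiffAt
  have h := Γ.velocity_target_mem_orbitDirection hc (g := B.arrow u)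
    (by simp only [Function.comp, zero_smul, add_zero]) (by
    filter_upwards [hline] with τ hτ
    exact B.source_arrow _ hτ _ hu (by simp))
  have heq : Γ.target ∘ (B.arrow ∘ fun τ : ℝ => u + τ • ((b, 0) : _ × EuclideanSpace ℝ (Fin j)))
      =ᶠ[𝓝 0] B.chart.symm ∘ fun τ : ℝ => u + τ • ((b, 0) : _ × EuclideanSpace ℝ (Fin j)) := by
    filter_upwards [hline] with τ hτ using B.target_arrow _ hτ
  rwa [heq.velocity_eq, B.velocity_symm_line hu] at h

/-- If an orbit has the same dimension as the plaques, it is tangent to the plaques. -/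
theorem modelDeriv_chart_snd_eq_zero {h : G} (hh : Γ.target h ∈ B.chart.source)
    (hk : Module.finrank ℝ (Γ.orbitDirection h) = k) {w : EuclideanSpace ℝ (Fin m)}
    (hw : w ∈ Γ.orbitDirection h) :
    (modelDeriv (𝓡 m) 𝓘(ℝ, EuclideanSpace ℝ (Fin k) × EuclideanSpace ℝ (Fin j))
      B.chart (Γ.target h) w).2 = 0 := by
  have hu := B.chart.map_source hh
  let P : EuclideanSpace ℝ (Fin k) →ₗ[ℝ] EuclideanSpace ℝ (Fin m) :=
    (modelDeriv 𝓘(ℝ, EuclideanSpace ℝ (Fin k) × EuclideanSpace ℝ (Fin j)) (𝓡 m)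
      B.chart.symm (B.chart (Γ.target h))).toLinearMap ∘ₗ LinearMap.inl ℝ _ _
  have hinv : ∀ b, modelDeriv (𝓡 m) 𝓘(ℝ, EuclideanSpace ℝ (Fin k) × EuclideanSpace ℝ (Fin j))
      B.chart (Γ.target h) (P b) = (b, 0) := fun b =>
    modelDeriv_leftInverse (B.mdifferentiableAt_symm hu) (B.mdifferentiableAt_chart hh)
      (B.chart.left_inv hh) (B.chart.eventually_right_inverse hu) _
  have hP : Function.Injective P := fun b b' hb => by
    have h1 := hinv b
    rw [hb, hinv b'] at h1
    exact (congrArg Prod.fst h1).symm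
  have hle : LinearMap.range P ≤ Γ.orbitDirection h := by
    rintro _ ⟨b, rfl⟩
    have h1 := B.modelDeriv_symm_mem_orbitDirection hu b
    rwa [Γ.orbitDirection_eq_of_target_eq (h := h)
      (by rw [B.target_arrow _ hu, B.chart.left_inv hh])] at h1
  -- Plaque directions are always orbit directions; equality of dimensions leaves no others.
  have heq : LinearMap.range P = Γ.orbitDirection h :=
    Submodule.eq_of_le_of_finrank_eq hle (by
      rw [LinearMap.finrank_range_of_inj hP, hk, finrank_euclideanSpace_fin])
  rw [← heq] at hw
  obtain ⟨b, rfl⟩ := hw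
  rw [hinv]

/-- The transverse coordinate is locally constant along the source fibre of `x` if the orbit of `x`
has the dimension of the plaques. -/
theorem eventually_snd_chart_target_eq {g : G} (hg : Γ.target g ∈ B.chart.source)
    (hk : Module.finrank ℝ (Γ.orbitDirection g) = k) :
    ∀ᶠ h in 𝓝 g, Γ.source h = Γ.source g →
      (B.chart (Γ.target h)).2 = (B.chart (Γ.target g)).2 := by
  obtain ⟨φ, hφ, χ, hχ, ℓ, -, hgφ, hmaps, hsℓ⟩ := Γ.isSubmersion_source.exists_charts_linear g
  have hW : IsOpen (φ.target ∩ φ.symm ⁻¹' (Γ.target ⁻¹' B.chart.source)) :=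
    φ.symm.isOpen_inter_preimage (B.chart.open_source.preimage Γ.continuous_target)
  obtain ⟨r, hr, hrW⟩ := Metric.isOpen_iff.1 hW (φ g)
    ⟨φ.map_source hgφ, by simpa [φ.left_inv hgφ] using hg⟩
  filter_upwards [φ.open_source.mem_nhds hgφ,
    (φ.continuousAt hgφ).preimage_mem_nhds (Metric.ball_mem_nhds _ hr)] with h hh hhr hsh
  -- The segment from `φ g` to `φ h` stays in the ball by convexity, and in the source fibre because
  -- `ℓ` kills its direction.
  let a : ℝ → EuclideanSpace ℝ (Fin n) := fun τ => φ g + τ • (φ h - φ g)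
  have haW : ∀ τ ∈ Icc (0 : ℝ) 1, a τ ∈ φ.target ∩ φ.symm ⁻¹' (Γ.target ⁻¹' B.chart.source) :=
    fun τ hτ => hrW ((convex_ball (φ g) r).add_smul_sub_mem (Metric.mem_ball_self hr) hhr hτ)
  have hℓ : ℓ (φ h - φ g) = 0 := by
    rw [map_sub, ← hsℓ _ hh, ← hsℓ _ hgφ, hsh, sub_self]
  have ha : ContDiff ℝ ∞ a := by fun_prop
  have hsa : ∀ τ, a τ ∈ φ.target → Γ.source (φ.symm (a τ)) = Γ.source g := fun τ hτ => by
    have h1 := φ.map_target hτ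
    refine χ.injOn (hmaps h1) (hmaps hgφ) ?_
    rw [hsℓ _ h1, hsℓ _ hgφ, φ.right_inv hτ]
    simp only [a, map_add, map_smul, hℓ, smul_zero, add_zero]
  let q : ℝ → EuclideanSpace ℝ (Fin k) × EuclideanSpace ℝ (Fin j) :=
    B.chart ∘ Γ.target ∘ φ.symm ∘ a
  have hq : ∀ τ ∈ Icc (0 : ℝ) 1, HasDerivAt (fun τ => (q τ).2) 0 τ := fun τ hτ => by
    obtain ⟨hτt, hτs⟩ := haW τ hτ
    have hc : ContMDiffAt 𝓘(ℝ, ℝ) (𝓡 n) ∞ (φ.symm ∘ a) τ :=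
      (contMDiffAt_symm_of_mem_maximalAtlas hφ hτt).comp τ ha.contDiffAt.contMDiffAt
    have hev : ∀ᶠ σ in 𝓝 τ, a σ ∈ φ.target :=
      ha.continuous.continuousAt.preimage_mem_nhds (φ.open_target.mem_nhds hτt)
    have hv := Γ.velocity_target_mem_orbitDirection hc rfl (by
      filter_upwards [hev] with σ hσ
      exact (hsa σ hσ).trans (hsa τ hτt).symm)
    have hkτ : Module.finrank ℝ (Γ.orbitDirection ((φ.symm ∘ a) τ)) = k := by
      rw [Γ.finrank_orbitDirection_eq, show Γ.source ((φ.symm ∘ a) τ) = Γ.source g from hsa τ hτt,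
        ← Γ.finrank_orbitDirection_eq, hk]
    have htc : MDifferentiableAt 𝓘(ℝ, ℝ) (𝓡 m) (Γ.target ∘ φ.symm ∘ a) τ :=
      (Γ.mdifferentiableAt_target _).comp τ (hc.mdifferentiableAt (by simp))
    have h0 := B.modelDeriv_chart_snd_eq_zero hτs hkτ hv
    rw [← velocity_comp (B.mdifferentiableAt_chart hτs) htc rfl, velocity_eq_deriv] at h0
    have hqd : DifferentiableAt ℝ q τ :=
      ((B.mdifferentiableAt_chart hτs).comp τ htc).differentiableAt
    have := (ContinuousLinearMap.snd ℝ (EuclideanSpace ℝ (Fin k))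
      (EuclideanSpace ℝ (Fin j))).hasFDerivAt.comp_hasDerivAt τ hqd.hasDerivAt
    rw [← h0]
    exact this
  have h1 := constant_of_has_deriv_right_zero (fun τ hτ => (hq τ hτ).continuousAt.continuousWithinAt)
    (fun τ hτ => (hq τ (Ico_subset_Icc_self hτ)).hasDerivWithinAt) 1 (by simp)
  simpa [q, a, φ.left_inv hh, φ.left_inv hgφ] using h1

/-- The box arrows at `u` and `v` have the same source, so one composed with the inverse of the
other joins the two points. -/
theorem symm_mem_orbit {x : M} {u v : EuclideanSpace ℝ (Fin k) × EuclideanSpace ℝ (Fin j)}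
    (hu : u ∈ B.chart.target) (hv : v ∈ B.chart.target) (huv : u.2 = v.2)
    (h : B.chart.symm u ∈ Γ.orbit x) : B.chart.symm v ∈ Γ.orbit x := by
  obtain ⟨g, hgs, hgt⟩ := h
  have h1 : Γ.source (B.arrow v) = Γ.target (Γ.inv (B.arrow u)) := by
    rw [Γ.target_inv, B.source_arrow _ hu _ hv huv]
  have h2 : Γ.source (Γ.mul (B.arrow v) (Γ.inv (B.arrow u))) = Γ.target g := by
    rw [Γ.source_mul _ _ h1, Γ.source_inv, B.target_arrow _ hu, hgt]
  exact ⟨Γ.mul (Γ.mul (B.arrow v) (Γ.inv (B.arrow u))) g, by rw [Γ.source_mul _ _ h2, hgs],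
    by rw [Γ.target_mul _ _ h2, Γ.target_mul _ _ h1, B.target_arrow _ hv]⟩

end OrbitBox

/-- If the groupoid is proper at `x`, every point of the orbit of `x` has an orbit box that the
orbit meets in one plaque only. -/
theorem IsProperAt.exists_orbitBox [T2Space M] [IsManifold (𝓡 m) ∞ M]
    {Γ : LieGroupoid n m G M} {x : M} (hx : Γ.IsProperAt x) {k j : ℕ}
    (hk : Module.finrank ℝ (Γ.orbitDirection (Γ.unit x)) = k) (hj : m = k + j)
    {y : M} (hy : y ∈ Γ.orbit x) :
    ∃ B : Γ.OrbitBox k j y, ∀ z ∈ B.chart.source, z ∈ Γ.orbit x ↔ (B.chart z).2 = 0 := by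
  obtain ⟨g, hg, rfl⟩ := hy
  have hkx : ∀ h, Γ.source h = x → Module.finrank ℝ (Γ.orbitDirection h) = k := fun h hh => by
    rw [Γ.finrank_orbitDirection_eq, hh, hk]
  obtain ⟨B⟩ := Γ.nonempty_orbitBox g (hkx g hg) hj
  have key : ∃ r, 0 < r ∧ r ≤ B.radius ∧ ∀ u ∈ Metric.ball
      (0 : EuclideanSpace ℝ (Fin k) × EuclideanSpace ℝ (Fin j)) r,
      B.chart.symm u ∈ Γ.orbit x → u.2 = 0 := by
    -- Otherwise orbit points off the central plaque converge to the centre; the minimum with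
    -- `B.radius` keeps them in the box.
    by_contra! H
    have hr : ∀ i : ℕ, 0 < min B.radius (1 / ((i : ℝ) + 1)) := fun i =>
      lt_min B.radius_pos (by positivity)
    choose u hu huO hu0 using fun i : ℕ => H _ (hr i) (min_le_left _ _)
    choose h hhs hht using huO
    have hut : ∀ i, u i ∈ B.chart.target := fun i => by
      rw [B.chart_target]
      exact Metric.ball_subset_ball (min_le_left _ _) (hu i)
    have h0t : (0 : EuclideanSpace ℝ (Fin k) × EuclideanSpace ℝ (Fin j)) ∈ B.chart.target := by
      rw [B.chart_target]; exact Metric.mem_ball_self B.radius_pos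
    have hsymm0 : B.chart.symm 0 = Γ.target g := by
      rw [← B.chart_self, B.chart.left_inv B.mem_source]
    have hu_lim : Tendsto u atTop (𝓝 0) := by
      rw [tendsto_zero_iff_norm_tendsto_zero]
      refine squeeze_zero (fun i => norm_nonneg _) (fun i => ?_)
        tendsto_one_div_add_atTop_nhds_zero_nat
      exact (mem_ball_zero_iff.1 (hu i)).le.trans (min_le_right _ _)
    have ht : Tendsto (fun i => Γ.target (h i)) atTop (𝓝 (Γ.target g)) := by
      simp only [hht]
      have h1 := (B.chart.symm.continuousAt (by simpa using h0t)).tendsto.comp hu_lim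
      rwa [hsymm0] at h1
    obtain ⟨a, φ, hφ, ha, has, hat⟩ := hx.exists_subseq_tendsto hhs hg ht
    -- The limit arrow `a` ends at the centre, so the transverse coordinate is 0 on nearby arrows
    -- from `x`.
    have hloc := B.eventually_snd_chart_target_eq (by rw [hat]; exact B.mem_source) (hkx a has)
    obtain ⟨i, hi⟩ := (ha.eventually hloc).exists
    have h1 := hi ((hhs _).trans has.symm)
    rw [Function.comp, hht, B.chart.right_inv (hut _), hat, B.chart_self] at h1
    exact hu0 _ h1
  obtain ⟨r, hr, hrB, hrO⟩ := key
  refine ⟨B.shrink r hr hrB, fun z hz => ?_⟩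
  have hzt := (B.shrink r hr hrB).chart.map_source hz
  have hz' := (B.shrink r hr hrB).chart.left_inv hz
  constructor
  · intro hzO
    rw [(B.shrink r hr hrB).chart_target] at hzt
    refine hrO _ hzt ?_
    change (B.shrink r hr hrB).chart.symm ((B.shrink r hr hrB).chart z) ∈ _
    rwa [hz']
  · intro hz0
    rw [← hz']
    have h0 := (B.shrink r hr hrB).mem_source
    refine (B.shrink r hr hrB).symm_mem_orbit ((B.shrink r hr hrB).chart.map_source h0) hzt ?_ ?_
    · rw [hz0, (B.shrink r hr hrB).chart_self]; rfl
    · rw [(B.shrink r hr hrB).chart.left_inv h0]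
      exact ⟨g, hg, rfl⟩

end LieGroupoid

/-! ### Embedded submanifolds from adapted charts -/

section SliceChart

variable {m d c : ℕ} {M : Type*} [TopologicalSpace M]

/-- The chart of a subset `S` induced by a chart of `M` in which `S` is the zero set of the second
coordinate. -/
noncomputable def sliceChart {S : Set M}
    (ψ : OpenPartialHomeomorph M (EuclideanSpace ℝ (Fin d) × EuclideanSpace ℝ (Fin c)))
    (hψ : ∀ z ∈ ψ.source, z ∈ S ↔ (ψ z).2 = 0) (y : S) :
    OpenPartialHomeomorph S (EuclideanSpace ℝ (Fin d)) := by
  classical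
  -- The value `y` only makes the map total; it is never taken on the chart target.
  let inv : EuclideanSpace ℝ (Fin d) → S := fun u =>
    if h : ψ.symm (u, 0) ∈ S then ⟨ψ.symm (u, 0), h⟩ else y
  have hinv : ∀ u : EuclideanSpace ℝ (Fin d), (u, 0) ∈ ψ.target → (inv u : M) = ψ.symm (u, 0) :=
    fun u hu => by
      have : ψ.symm (u, 0) ∈ S := (hψ _ (ψ.map_target hu)).2 (by rw [ψ.right_inv hu])
      simp [inv, this]
  have hfst : ∀ z : S, (z : M) ∈ ψ.source → ((ψ z).1, 0) = ψ z := fun z hz =>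
    Prod.ext rfl ((hψ z hz).1 z.2).symm
  exact {
    toFun := fun z => (ψ z).1
    invFun := inv
    source := Subtype.val ⁻¹' ψ.source
    target := {u | (u, 0) ∈ ψ.target}
    map_source' := fun z hz => by
      change ((ψ z).1, 0) ∈ ψ.target
      rw [hfst z hz]
      exact ψ.map_source hz
    map_target' := fun u hu => by
      rw [mem_preimage, hinv u hu]
      exact ψ.map_target hu
    left_inv' := fun z hz => Subtype.ext <| by
      rw [hinv _ (by rw [hfst z hz]; exact ψ.map_source hz), hfst z hz, ψ.left_inv hz]
    right_inv' := fun u hu => by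
      rw [hinv u hu, ψ.right_inv hu]
    open_source := ψ.open_source.preimage continuous_subtype_val
    open_target := ψ.open_target.preimage (by fun_prop)
    continuousOn_toFun := continuous_fst.comp_continuousOn
      (ψ.continuousOn.comp continuous_subtype_val.continuousOn fun _ h => h)
    continuousOn_invFun := by
      rw [IsEmbedding.subtypeVal.isInducing.continuousOn_iff]
      refine ContinuousOn.congr (f := fun u : EuclideanSpace ℝ (Fin d) => ψ.symm (u, 0)) ?_ hinv
      exact ψ.continuousOn_symm.comp (by fun_prop) fun _ h => h }

variable {S : Set M}
    (ψ : OpenPartialHomeomorph M (EuclideanSpace ℝ (Fin d) × EuclideanSpace ℝ (Fin c)))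
    (hψ : ∀ z ∈ ψ.source, z ∈ S ↔ (ψ z).2 = 0) (y : S)

theorem apply_sliceChart_symm {u : EuclideanSpace ℝ (Fin d)}
    (hu : u ∈ (sliceChart ψ hψ y).target) :
    ψ ((sliceChart ψ hψ y).symm u : M) = (u, 0) := by
  have h1 := (sliceChart ψ hψ y).map_target hu
  have h2 := (sliceChart ψ hψ y).right_inv hu
  exact Prod.ext h2 ((hψ _ h1).1 ((sliceChart ψ hψ y).symm u).2)

theorem coe_sliceChart_symm {u : EuclideanSpace ℝ (Fin d)}
    (hu : u ∈ (sliceChart ψ hψ y).target) :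
    ((sliceChart ψ hψ y).symm u : M) = ψ.symm (u, 0) := by
  have h1 := (sliceChart ψ hψ y).map_target hu
  rw [← apply_sliceChart_symm ψ hψ y hu, ψ.left_inv h1]

variable [ChartedSpace (EuclideanSpace ℝ (Fin m)) M] [IsManifold (𝓡 m) ∞ M]

/-- A subset that is, near each of its points, the zero set of the second coordinate in a smooth
chart is an embedded submanifold. -/
theorem exists_embeddedSubmanifold (hm : m = d + c)
    (H : ∀ y ∈ S, ∃ ψ : OpenPartialHomeomorph M
      (EuclideanSpace ℝ (Fin d) × EuclideanSpace ℝ (Fin c)), y ∈ ψ.source ∧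
      ContMDiffOn (𝓡 m) 𝓘(ℝ, EuclideanSpace ℝ (Fin d) × EuclideanSpace ℝ (Fin c)) ∞ ψ ψ.source ∧
      ContMDiffOn 𝓘(ℝ, EuclideanSpace ℝ (Fin d) × EuclideanSpace ℝ (Fin c)) (𝓡 m) ∞
        ψ.symm ψ.target ∧ ∀ z ∈ ψ.source, z ∈ S ↔ (ψ z).2 = 0) :
    ∃ N : EmbeddedSubmanifold m S, N.dim = d := by
  choose ψ hyψ hψ hψsymm hψS using fun y : S => H y y.2
  let e : S → OpenPartialHomeomorph S (EuclideanSpace ℝ (Fin d)) := fun y =>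
    sliceChart (ψ y) (hψS y) y
  let C : ChartedSpace (EuclideanSpace ℝ (Fin d)) S := {
    atlas := range e
    chartAt := e
    mem_chart_source := hyψ
    chart_mem_atlas := fun y => ⟨y, rfl⟩ }
  have hmfd : IsManifold (𝓡 d) ∞ S := by
    refine isManifold_of_contDiffOn _ _ _ ?_
    rintro _ _ ⟨y, rfl⟩ ⟨y', rfl⟩
    have hset : (𝓡 d).symm ⁻¹' ((e y).symm.trans (e y')).source ∩ range (𝓡 d) =
        ((e y).symm.trans (e y')).source := by simp
    rw [hset, ← contMDiffOn_iff_contDiffOn]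
    -- A transition map is `u ↦ (u, 0)`, followed by a transition of ambient charts and the first
    -- projection.
    have h1 : ContMDiffOn (𝓡 d) 𝓘(ℝ, EuclideanSpace ℝ (Fin d) × EuclideanSpace ℝ (Fin c)) ∞
        (fun u : EuclideanSpace ℝ (Fin d) => (u, (0 : EuclideanSpace ℝ (Fin c))))
        ((e y).symm.trans (e y')).source := by
      rw [contMDiffOn_iff_contDiffOn]; fun_prop
    have h2 : ContMDiffOn (𝓡 d) (𝓡 m) ∞ (fun u => ((e y).symm u : M))
        ((e y).symm.trans (e y')).source :=
      ((hψsymm y).comp h1 fun u hu => hu.1).congr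
        fun u hu => coe_sliceChart_symm (ψ y) (hψS y) y hu.1
    have h3 : ContMDiffOn (𝓡 d) 𝓘(ℝ, EuclideanSpace ℝ (Fin d) × EuclideanSpace ℝ (Fin c)) ∞
        (fun u => ψ y' ((e y).symm u : M)) ((e y).symm.trans (e y')).source :=
      (hψ y').comp h2 fun u hu => hu.2
    rw [contMDiffOn_iff_contDiffOn] at h3 ⊢
    exact contDiff_fst.comp_contDiffOn h3
  let ε : (EuclideanSpace ℝ (Fin d) × EuclideanSpace ℝ (Fin c)) ≃L[ℝ] EuclideanSpace ℝ (Fin m) :=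
    ContinuousLinearEquiv.ofFinrankEq (by simp [hm])
  refine ⟨⟨d, C, hmfd, ⟨?_, IsEmbedding.subtypeVal⟩⟩, rfl⟩
  refine IsImmersionOfComplement.isImmersion (F := EuclideanSpace ℝ (Fin c)) fun y => ?_
  refine IsImmersionAtOfComplement.mk_of_continuousAt continuous_subtype_val.continuousAt ε
    (e y) ((ψ y).transHomeomorph ε.toHomeomorph) (hyψ y) (hyψ y)
    (IsManifold.chart_mem_maximalAtlas y)
    (OpenPartialHomeomorph.mem_maximalAtlas_of_contMDiffOn _ ?_ ?_) fun u hu => ?_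
  · have hε : ContMDiff 𝓘(ℝ, EuclideanSpace ℝ (Fin d) × EuclideanSpace ℝ (Fin c)) (𝓡 m) ∞ ε := by
      rw [contMDiff_iff_contDiff]; exact ε.contDiff
    exact hε.comp_contMDiffOn (hψ y)
  · have hε : ContMDiff (𝓡 m) 𝓘(ℝ, EuclideanSpace ℝ (Fin d) × EuclideanSpace ℝ (Fin c)) ∞
        ε.symm := by
      rw [contMDiff_iff_contDiff]; exact ε.symm.contDiff
    exact (hψsymm y).comp hε.contMDiffOn fun u hu => hu
  · have hu' : u ∈ (e y).target := by simpa using hu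
    change ε (ψ y ((e y).symm u : M)) = ε (u, 0)
    rw [apply_sliceChart_symm (ψ y) (hψS y) y hu']

end SliceChart

/-! ### The canonical structure of the orbit and the slice -/

namespace LieGroupoid

variable {n m : ℕ} {G M : Type*}
  [TopologicalSpace G] [ChartedSpace (EuclideanSpace ℝ (Fin n)) G]
  [TopologicalSpace M] [ChartedSpace (EuclideanSpace ℝ (Fin m)) M]

/-- A submanifold structure on the orbit of the expected dimension and with the quotient topology
is the canonical one. -/
theorem isOrbitStructure_of_dim {Γ : LieGroupoid n m G M} {x : M}
    (hq : IsQuotientMap (Γ.orbitMap x)) (O : EmbeddedSubmanifold m (Γ.orbit x))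
    (hO : O.dim = Module.finrank ℝ (Γ.orbitDirection (Γ.unit x))) : Γ.IsOrbitStructure O := by
  refine ⟨hq, fun g => ?_⟩
  have hle : Γ.orbitDirection (g : G) ≤ O.tangentSpace (Γ.orbitMap x g) := fun w hw => by
    obtain ⟨c, hc0, hc, hs, rfl⟩ := Γ.exists_curve_of_mem_orbitDirection hw
    refine O.velocity_mem_tangentSpace
      (Γ.isSubmersion_target.contMDiff.contMDiffAt.comp (0 : ℝ) hc) ?_ ?_
    · filter_upwards [hs] with τ hτ
      exact ⟨c τ, hτ.trans g.2, rfl⟩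
    · change Γ.target (c 0) = Γ.target g
      rw [hc0]
  -- The inclusion is an equality because the tangent space has dimension at most `O.dim`.
  have hdim : Module.finrank ℝ (Γ.orbitDirection (g : G)) = O.dim := by
    rw [hO, Γ.finrank_orbitDirection_eq, g.2]
  have heq : ∀ A B : Submodule ℝ (EuclideanSpace ℝ (Fin m)), A ≤ B →
      Module.finrank ℝ B ≤ Module.finrank ℝ A → A = B :=
    fun _ _ => Submodule.eq_of_le_of_finrank_le
  exact (heq _ _ hle ((O.finrank_tangentSpace_le _).trans hdim.ge)).symm

/-- The transversal through the centre of an orbit box is a slice, if the orbit meets the box in one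
plaque only. -/
theorem OrbitBox.exists_isSlice [IsManifold (𝓡 m) ∞ M] {Γ : LieGroupoid n m G M} {x : M} {k j : ℕ}
    (hk : Module.finrank ℝ (Γ.orbitDirection (Γ.unit x)) = k) (hj : m = k + j)
    (B : Γ.OrbitBox k j x) (hB : ∀ z ∈ B.chart.source, z ∈ Γ.orbit x ↔ (B.chart z).2 = 0) :
    ∃ (S : Set M) (N : EmbeddedSubmanifold m S), Γ.IsSlice x N := by
  let S : Set M := {z | z ∈ B.chart.source ∧ (B.chart z).1 = 0}
  have hxS : x ∈ S := ⟨B.mem_source, by rw [B.chart_self]; rfl⟩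
  -- The coordinates are exchanged because a submanifold chart needs the vanishing coordinate
  -- second.
  let swap := ContinuousLinearEquiv.prodComm ℝ (EuclideanSpace ℝ (Fin k)) (EuclideanSpace ℝ (Fin j))
  obtain ⟨N, hN⟩ := exists_embeddedSubmanifold (S := S) (d := j) (c := k)
    (hj.trans (Nat.add_comm k j)) fun y hy => by
      refine ⟨B.chart.transHomeomorph swap.toHomeomorph, hy.1, ?_, ?_,
        fun z hz => ⟨fun h => h.2, fun h => ⟨hz, h⟩⟩⟩
      · have hs : ContMDiff 𝓘(ℝ, EuclideanSpace ℝ (Fin k) × EuclideanSpace ℝ (Fin j))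
            𝓘(ℝ, EuclideanSpace ℝ (Fin j) × EuclideanSpace ℝ (Fin k)) ∞ swap := by
          rw [contMDiff_iff_contDiff]; exact swap.contDiff
        exact hs.comp_contMDiffOn B.contMDiffOn_chart
      · have hs : ContMDiff 𝓘(ℝ, EuclideanSpace ℝ (Fin j) × EuclideanSpace ℝ (Fin k))
            𝓘(ℝ, EuclideanSpace ℝ (Fin k) × EuclideanSpace ℝ (Fin j)) ∞ swap.symm := by
          rw [contMDiff_iff_contDiff]; exact swap.symm.contDiff
        exact B.contMDiffOn_symm.comp hs.contMDiffOn fun u hu => hu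
  refine ⟨S, N, hxS, fun g hg => ?_, ?_, ?_⟩
  · have hu := B.chart.map_source hg.1
    have hgu : Γ.target (B.arrow (B.chart (Γ.target g))) = Γ.target g := by
      rw [B.target_arrow _ hu, B.chart.left_inv hg.1]
    refine eq_top_iff.2 fun w _ => ?_
    let w' : EuclideanSpace ℝ (Fin k) × EuclideanSpace ℝ (Fin j) :=
      modelDeriv (𝓡 m) 𝓘(ℝ, EuclideanSpace ℝ (Fin k) × EuclideanSpace ℝ (Fin j))
        B.chart (Γ.target g) w
    let D := modelDeriv 𝓘(ℝ, EuclideanSpace ℝ (Fin k) × EuclideanSpace ℝ (Fin j)) (𝓡 m)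
      B.chart.symm (B.chart (Γ.target g))
    have hw : D w' = w := modelDeriv_leftInverse (B.mdifferentiableAt_chart hg.1)
      (B.mdifferentiableAt_symm hu) rfl (B.chart.eventually_left_inverse hg.1) _
    -- In box coordinates a vector splits into a part along `S` and a part along the plaque. Only
    -- the inclusion of plaque directions in orbit directions is used, so orbits of any dimension
    -- are allowed.
    refine Submodule.mem_sup.2 ⟨D (0, w'.2), ?_, D (w'.1, 0), ?_, ?_⟩
    · have hline := B.eventually_line_mem hu ((0, w'.2) : EuclideanSpace ℝ (Fin k) × _)
      have hl : ContDiff ℝ ∞ fun τ : ℝ =>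
        B.chart (Γ.target g) + τ • ((0, w'.2) : EuclideanSpace ℝ (Fin k) × _) := by fun_prop
      have h0 : (B.chart.symm ∘ fun τ : ℝ =>
          B.chart (Γ.target g) + τ • ((0, w'.2) : EuclideanSpace ℝ (Fin k) × _)) 0 =
            Γ.target g := by
        simp only [Function.comp, zero_smul, add_zero, B.chart.left_inv hg.1]
      have h1 := N.velocity_mem_tangentSpace (y := ⟨Γ.target g, hg⟩)
        (ContMDiffAt.comp (0 : ℝ) (B.contMDiffOn_symm.contMDiffAt
          (B.chart.open_target.mem_nhds (by simpa only [zero_smul, add_zero] using hu)))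
            hl.contDiffAt.contMDiffAt) (by
          filter_upwards [hline] with τ hτ
          refine ⟨B.chart.map_target hτ, ?_⟩
          simp only [Function.comp]
          rw [B.chart.right_inv hτ]
          simp [hg.2]) h0
      rwa [B.velocity_symm_line hu] at h1
    · have h1 := B.modelDeriv_symm_mem_orbitDirection hu w'.1
      rwa [Γ.orbitDirection_eq_of_target_eq hgu] at h1
    · refine Eq.trans ?_ hw
      refine (map_add D _ _).symm.trans (congrArg D ?_)
      exact Prod.ext (zero_add _) (add_zero _)
  · exact (congrArg₂ (· + ·) hN hk).trans ((add_comm j k).trans hj.symm)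
  · refine Subset.antisymm (fun z hz => ?_) (singleton_subset_iff.2 ⟨hxS, ?_⟩)
    · refine B.chart.injOn hz.1.1 B.mem_source ?_
      rw [B.chart_self]
      exact Prod.ext hz.1.2 ((hB z hz.1.1).1 hz.2)
    · exact ⟨Γ.unit x, Γ.source_unit x, Γ.target_unit x⟩

end LieGroupoid

theorem mainTheorem9 {n m : ℕ} {G M : Type*}
    [TopologicalSpace G] [T2Space G] [SecondCountableTopology G]
    [ChartedSpace (EuclideanSpace ℝ (Fin n)) G] [IsManifold (𝓡 n) ∞ G]
    [TopologicalSpace M] [T2Space M] [SecondCountableTopology M]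
    [ChartedSpace (EuclideanSpace ℝ (Fin m)) M] [IsManifold (𝓡 m) ∞ M]
    (Γ : LieGroupoid n m G M) (x : M) (hx : Γ.IsProperAt x) :
    (∃ O : EmbeddedSubmanifold m (Γ.orbit x), Γ.IsOrbitStructure O) ∧
    (∃ (S : Set M) (N : EmbeddedSubmanifold m S), Γ.IsSlice x N) := by
  -- `j` is the codimension of the orbit, and becomes the dimension of the slice.
  obtain ⟨j, hj⟩ := Nat.exists_eq_add_of_le
    (show Module.finrank ℝ (Γ.orbitDirection (Γ.unit x)) ≤ m from
      (Submodule.finrank_le _).trans_eq finrank_euclideanSpace_fin)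
  constructor
  · obtain ⟨O, hO⟩ := exists_embeddedSubmanifold (S := Γ.orbit x) hj fun y hy => by
      obtain ⟨B, hB⟩ := hx.exists_orbitBox rfl hj hy
      exact ⟨B.chart, B.mem_source, B.contMDiffOn_chart, B.contMDiffOn_symm, hB⟩
    exact ⟨O, LieGroupoid.isOrbitStructure_of_dim hx.isQuotientMap_orbitMap O hO⟩
  · obtain ⟨B, hB⟩ := hx.exists_orbitBox rfl hj (y := x)
      ⟨Γ.unit x, Γ.source_unit x, Γ.target_unit x⟩
    exact B.exists_isSlice rfl hj hB
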